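/- Let $l\ge 3$, let $\eta=\mathrm{diag}(1,1,-1,\dots,-1)$ on $\mathbb R^{2,l-1}$ with standard basis $e_u,e_t$ (time-like), $e_{x_1},\dots,e_{x_{l-1}}$ (space-like), and let $G=\mathrm{SO}(2,l-1)$ be the group of real matrices of determinant one preserving $\eta$, $H=\mathrm{SO}(1,l-1)$ the stabilizer of $e_u$ in $G$, $AdS_l=G/H$ with the quotient topology and projection $\pi(g)=[g]$. Let $\mathcal G=\mathfrak{so}(2,l-1)$ with Killing form $B$ and $\|X\|=-\frac{1}{2(l-1)}B(X,X)$ (a quadratic expression, no square root). Let $\theta X=-X^{T}$, let $\sigma$ be conjugation by $\mathrm{diag}(-1,1,\dots,1)$, let $\mathcal Q$ be the $(-1)$-eigenspace of $\sigma$ and $\mathrm{pr}_{\mathcal Q}X=\frac12(X-\sigma X)$. Let $J_1$ be the boost generator exchanging $e_t$ and $e_{x_1}$, and $J_2$ the boost generator exchanging $e_u$ and $e_{x_2}$, $\mathcal A=\langle J_1,J_2\rangle$, let $\mathcal N$ be the sum of the root spaces $\{X: [J_1,X]=\alpha X,\ [J_2,X]=\beta X\}$ for $(\alpha,\beta)\in\{(1,0),(0,1),(1,1),(1,-1)\}$,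 and $\bar{\mathcal N}=\theta\mathcal N$. Let $A,N,\bar N$ be the subgroups of $G$ generated by the exponentials of $\mathcal A,\mathcal N,\bar{\mathcal N}$. The singularity $\mathcal S\subset AdS_l$ is the union of all closed orbits of $AN$ and all closed orbits of $A\bar N$ in $AdS_l$. Let $(J_1^*)_{p}=\frac{d}{dt}\big|_{t=0}\,e^{-tJ_1}\cdot p$ be the fundamental vector field of $J_1$, and let the norm of a tangent vector $d\pi_g\,dL_g X$ at $[g]$, $X\in\mathcal Q$, be $\|X\|$. Then for every $g\in G$, $(J_1^*)_{[g]}$ is a tangent vector of the form $d\pi_g\,dL_gX$ with $X\in\mathcal Q$, and $$\|J_1^*\|_{[g]}=\|\mathrm{pr}_{\mathcal Q}\,\mathrm{Ad}(g^{-1})J_1\|,$$ and $$\mathcal S=\{p\in AdS_l:\ \|J_1^*\|_{p}=0\};$$ equivalently, $[g]\in\mathcal S$ if and only if $\|\mathrm{pr}_{\mathcal Q}\,\mathrm{Ad}(g^{-1})J_1\|=0$. -/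

import Mathlib

noncomputable section

namespace BTZ

open Matrix

attribute [local instance 100] LieRing.ofAssociativeRing

/-- The index set of the coordinates `(u, t, x₁, …, x_{l-1})` of `ℝ^{2,l-1}`, where `l = m + 3`.
The natural number `m` encodes the dimension `l = m + 3 ≥ 3` of anti de Sitter space. -/
abbrev Idx (m : ℕ) : Type := Fin 2 ⊕ Fin (m + 2)

/-- The diagonal matrix `η = diag(1, 1, -1, …, -1)` of signature `(2, l-1)`. -/
abbrev eta (m : ℕ) : Matrix (Idx m) (Idx m) ℝ :=
  LieAlgebra.Orthogonal.indefiniteDiagonal (Fin 2) (Fin (m + 2)) ℝ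

/-! ### The group `G = SO(2, l-1)`, the subgroup `H = SO(1, l-1)` and `AdS_l = G/H` -/

/-- The underlying matrix of an element of the special linear group. -/
def slMat {m : ℕ} (g : SpecialLinearGroup (Idx m) ℝ) : Matrix (Idx m) (Idx m) ℝ := g.1

theorem slMat_mul {m : ℕ} (a b : SpecialLinearGroup (Idx m) ℝ) :
    slMat (a * b) = slMat a * slMat b := rfl

theorem slMat_one {m : ℕ} : slMat (1 : SpecialLinearGroup (Idx m) ℝ) = 1 := rfl

/-- `G = SO(2, l-1)`: the real matrices of determinant one that preserve `η`. -/
def G (m : ℕ) : Subgroup (SpecialLinearGroup (Idx m) ℝ) where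
  carrier := {g | (slMat g)ᵀ * eta m * slMat g = eta m}
  one_mem' := by
    change (slMat 1)ᵀ * eta m * slMat 1 = eta m
    rw [slMat_one, transpose_one, Matrix.one_mul, Matrix.mul_one]
  mul_mem' := by
    intro a b ha hb
    change (slMat a)ᵀ * eta m * slMat a = eta m at ha
    change (slMat b)ᵀ * eta m * slMat b = eta m at hb
    change (slMat (a * b))ᵀ * eta m * slMat (a * b) = eta m
    rw [slMat_mul, transpose_mul]
    calc _ = (slMat b)ᵀ * ((slMat a)ᵀ * eta m * slMat a) * slMat b := by
            simp only [Matrix.mul_assoc]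
      _ = _ := by rw [ha, hb]
  inv_mem' := by
    intro a ha
    change (slMat a)ᵀ * eta m * slMat a = eta m at ha
    change (slMat a⁻¹)ᵀ * eta m * slMat a⁻¹ = eta m
    have h1 : slMat a * slMat a⁻¹ = 1 := by rw [← slMat_mul, mul_inv_cancel, slMat_one]
    have h2 := congrArg transpose h1
    rw [transpose_mul, transpose_one] at h2
    calc _ = (slMat a⁻¹)ᵀ * ((slMat a)ᵀ * eta m * slMat a) * slMat a⁻¹ := by rw [ha]
      _ = ((slMat a⁻¹)ᵀ * (slMat a)ᵀ) * eta m * (slMat a * slMat a⁻¹) := by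
            simp only [Matrix.mul_assoc]
      _ = _ := by rw [h1, h2, Matrix.one_mul, Matrix.mul_one]

/-- The underlying matrix of an element of `G`. -/
def toMat {m : ℕ} (g : G m) : Matrix (Idx m) (Idx m) ℝ := slMat g.1

theorem toMat_mul {m : ℕ} (a b : G m) : toMat (a * b) = toMat a * toMat b := rfl

theorem toMat_one {m : ℕ} : toMat (1 : G m) = 1 := rfl

/-- The base vector `e_u = (1, 0, …, 0)`. -/
def baseVec (m : ℕ) : Idx m → ℝ := Pi.single (Sum.inl 0) 1

/-- `H = SO(1, l-1)`, embedded in `G` as the block matrices `diag(1, h)`, i.e. as the stabilizer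
of the first basis vector. -/
def H (m : ℕ) : Subgroup (G m) where
  carrier := {g | toMat g *ᵥ baseVec m = baseVec m}
  one_mem' := by
    change toMat 1 *ᵥ baseVec m = baseVec m
    rw [toMat_one, one_mulVec]
  mul_mem' := by
    intro a b ha hb
    change toMat a *ᵥ baseVec m = baseVec m at ha
    change toMat b *ᵥ baseVec m = baseVec m at hb
    change toMat (a * b) *ᵥ baseVec m = baseVec m
    rw [toMat_mul, ← mulVec_mulVec, hb, ha]
  inv_mem' := by
    intro a ha
    change toMat a *ᵥ baseVec m = baseVec m at ha
    change toMat a⁻¹ *ᵥ baseVec m = baseVec m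
    nth_rewrite 1 [← ha]
    rw [mulVec_mulVec, ← toMat_mul, inv_mul_cancel, toMat_one, one_mulVec]

/-- Anti de Sitter space `AdS_l = SO(2, l-1) / SO(1, l-1)`, `l = m + 3`, with the quotient
topology and the left action of `G`. -/
abbrev AdS (m : ℕ) : Type := G m ⧸ H m

/-- The canonical projection `π : G → G/H`, `π g = [g]`. -/
def proj {m : ℕ} (g : G m) : AdS m := QuotientGroup.mk g

/-! ### The Lie algebra `𝒢 = so(2, l-1)` -/

/-- `𝒢 = so(2, l-1)`. -/
abbrev so (m : ℕ) : LieSubalgebra ℝ (Matrix (Idx m) (Idx m) ℝ) :=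
  LieAlgebra.Orthogonal.so' (Fin 2) (Fin (m + 2)) ℝ

theorem mem_so_iff {m : ℕ} (X : Matrix (Idx m) (Idx m) ℝ) :
    X ∈ so m ↔ Xᵀ * eta m = -(eta m * X) := by
  rw [← Matrix.mul_neg]
  unfold so LieAlgebra.Orthogonal.so'
  rw [mem_skewAdjointMatricesLieSubalgebra, mem_skewAdjointMatricesSubmodule]
  rfl

theorem eta_mul_eta (m : ℕ) : eta m * eta m = 1 := by
  unfold eta LieAlgebra.Orthogonal.indefiniteDiagonal
  rw [diagonal_mul_diagonal, ← diagonal_one]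
  congr 1
  funext i
  rcases i with i | i <;> simp

theorem exp_preserves {m : ℕ} (X : so m) :
    (NormedSpace.exp (X : Matrix (Idx m) (Idx m) ℝ))ᵀ * eta m *
      NormedSpace.exp (X : Matrix (Idx m) (Idx m) ℝ) = eta m := by
  have hX := (mem_so_iff (X : Matrix (Idx m) (Idx m) ℝ)).1 X.2
  have hinv : (eta m)⁻¹ = eta m := Matrix.inv_eq_right_inv (eta_mul_eta m)
  have hu : IsUnit (eta m) := ⟨⟨eta m, eta m, eta_mul_eta m, eta_mul_eta m⟩, rfl⟩
  have h1 : (X : Matrix (Idx m) (Idx m) ℝ)ᵀ = eta m * (-(X : Matrix (Idx m) (Idx m) ℝ)) *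
      (eta m)⁻¹ := by
    rw [hinv, Matrix.mul_neg, ← hX, Matrix.mul_assoc, eta_mul_eta, Matrix.mul_one]
  have h2 : NormedSpace.exp (-(X : Matrix (Idx m) (Idx m) ℝ)) *
      NormedSpace.exp (X : Matrix (Idx m) (Idx m) ℝ) = 1 := by
    rw [← Matrix.exp_add_of_commute _ _ (Commute.neg_left (Commute.refl
      (X : Matrix (Idx m) (Idx m) ℝ))), neg_add_cancel,
      NormedSpace.exp_zero]
  rw [← Matrix.exp_transpose, h1, Matrix.exp_conj _ _ hu, hinv]
  calc _ = eta m * NormedSpace.exp (-(X : Matrix (Idx m) (Idx m) ℝ)) * (eta m * eta m) *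
        NormedSpace.exp (X : Matrix (Idx m) (Idx m) ℝ) := by simp only [Matrix.mul_assoc]
    _ = _ := by rw [eta_mul_eta, Matrix.mul_one, Matrix.mul_assoc, h2, Matrix.mul_one]

theorem det_exp_eq_one {m : ℕ} (X : so m) :
    (NormedSpace.exp (X : Matrix (Idx m) (Idx m) ℝ)).det = 1 := by
  have key : ∀ Y : so m, (NormedSpace.exp (Y : Matrix (Idx m) (Idx m) ℝ)).det *
      (NormedSpace.exp (Y : Matrix (Idx m) (Idx m) ℝ)).det = 1 := by
    intro Y
    have h := congrArg det (exp_preserves Y)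
    rw [det_mul, det_mul, det_transpose] at h
    have he : (eta m).det * (eta m).det = 1 := by rw [← det_mul, eta_mul_eta, det_one]
    have hne : (eta m).det ≠ 0 := fun h0 => by rw [h0] at he; simp at he
    apply mul_right_cancel₀ hne
    linarith
  have hhalf : NormedSpace.exp (X : Matrix (Idx m) (Idx m) ℝ) =
      NormedSpace.exp (((1 / 2 : ℝ) • X : so m) : Matrix (Idx m) (Idx m) ℝ) *
      NormedSpace.exp (((1 / 2 : ℝ) • X : so m) : Matrix (Idx m) (Idx m) ℝ) := by
    rw [← Matrix.exp_add_of_commute _ _ (Commute.refl _)]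
    congr 1
    change (X : Matrix (Idx m) (Idx m) ℝ) = (1 / 2 : ℝ) • (X : Matrix (Idx m) (Idx m) ℝ) +
      (1 / 2 : ℝ) • (X : Matrix (Idx m) (Idx m) ℝ)
    rw [← add_smul]
    norm_num
  rw [hhalf, det_mul]
  exact key _

/-- The exponential map `so(2, l-1) → SO(2, l-1)`. -/
def expG {m : ℕ} (X : so m) : G m :=
  ⟨⟨NormedSpace.exp (X : Matrix (Idx m) (Idx m) ℝ), det_exp_eq_one X⟩, exp_preserves X⟩

/-- The adjoint action `Ad(g) X = g X g⁻¹`. -/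
def Ad {m : ℕ} (g : G m) (X : so m) : so m :=
  ⟨toMat g * (X : Matrix (Idx m) (Idx m) ℝ) * toMat g⁻¹, by
    have hX := (mem_so_iff (X : Matrix (Idx m) (Idx m) ℝ)).1 X.2
    rw [mem_so_iff, transpose_mul, transpose_mul]
    have hg : (toMat g)ᵀ * eta m * toMat g = eta m := g.2
    have h1 : toMat g * toMat g⁻¹ = 1 := by
      rw [← toMat_mul, mul_inv_cancel, toMat_one]
    have h2 := congrArg transpose h1
    rw [transpose_mul, transpose_one] at h2
    have hg2 : (toMat g)ᵀ * eta m = eta m * toMat g⁻¹ := by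
      calc _ = (toMat g)ᵀ * eta m * (toMat g * toMat g⁻¹) := by rw [h1, Matrix.mul_one]
        _ = ((toMat g)ᵀ * eta m * toMat g) * toMat g⁻¹ := by simp only [Matrix.mul_assoc]
        _ = _ := by rw [hg]
    have hg3 : eta m * toMat g = (toMat g⁻¹)ᵀ * eta m := by
      calc _ = ((toMat g⁻¹)ᵀ * (toMat g)ᵀ) * (eta m * toMat g) := by rw [h2, Matrix.one_mul]
        _ = (toMat g⁻¹)ᵀ * ((toMat g)ᵀ * eta m * toMat g) := by simp only [Matrix.mul_assoc]
        _ = _ := by rw [hg]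
    calc _ = (toMat g⁻¹)ᵀ * (X : Matrix (Idx m) (Idx m) ℝ)ᵀ * ((toMat g)ᵀ * eta m) := by
            simp only [Matrix.mul_assoc]
      _ = (toMat g⁻¹)ᵀ * ((X : Matrix (Idx m) (Idx m) ℝ)ᵀ * eta m) * toMat g⁻¹ := by
            rw [hg2]; simp only [Matrix.mul_assoc]
      _ = -(((toMat g⁻¹)ᵀ * eta m) * (X : Matrix (Idx m) (Idx m) ℝ) * toMat g⁻¹) := by
            rw [hX]; simp only [Matrix.mul_assoc, Matrix.mul_neg, Matrix.neg_mul]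
      _ = _ := by rw [← hg3]; simp only [Matrix.mul_assoc]⟩

/-- The Cartan involution `θ X = -Xᵀ`. -/
def theta (m : ℕ) : so m →ₗ[ℝ] so m where
  toFun X := ⟨-(X : Matrix (Idx m) (Idx m) ℝ)ᵀ, by
    have hX := (mem_so_iff (X : Matrix (Idx m) (Idx m) ℝ)).1 X.2
    rw [mem_so_iff, transpose_neg, transpose_transpose, Matrix.mul_neg, neg_neg, Matrix.neg_mul]
    calc _ = -(eta m * eta m * ((X : Matrix (Idx m) (Idx m) ℝ) * eta m)) := by
            rw [eta_mul_eta, Matrix.one_mul]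
      _ = eta m * (-(eta m * (X : Matrix (Idx m) (Idx m) ℝ))) * eta m := by
            simp only [Matrix.mul_assoc, Matrix.mul_neg, Matrix.neg_mul]
      _ = eta m * (X : Matrix (Idx m) (Idx m) ℝ)ᵀ * (eta m * eta m) := by
            rw [← hX]; simp only [Matrix.mul_assoc]
      _ = _ := by rw [eta_mul_eta, Matrix.mul_one]⟩
  map_add' X Y := by
    apply Subtype.ext
    change -((X : Matrix (Idx m) (Idx m) ℝ) + (Y : Matrix (Idx m) (Idx m) ℝ))ᵀ =
      -(X : Matrix (Idx m) (Idx m) ℝ)ᵀ + -(Y : Matrix (Idx m) (Idx m) ℝ)ᵀ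
    rw [transpose_add, neg_add]
  map_smul' c X := by
    apply Subtype.ext
    change -(c • (X : Matrix (Idx m) (Idx m) ℝ))ᵀ = c • -(X : Matrix (Idx m) (Idx m) ℝ)ᵀ
    rw [transpose_smul, smul_neg]

/-- The reflection `diag(-1, 1, …, 1)` in the direction of the base vector. -/
def refl (m : ℕ) : Matrix (Idx m) (Idx m) ℝ :=
  Matrix.diagonal fun i => if i = Sum.inl 0 then -1 else 1

theorem refl_mul_eta (m : ℕ) : refl m * eta m = eta m * refl m := by
  unfold refl eta LieAlgebra.Orthogonal.indefiniteDiagonal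
  rw [diagonal_mul_diagonal, diagonal_mul_diagonal]
  congr 1
  funext i
  exact mul_comm _ _

/-- The involutive automorphism `σ` of `so(2, l-1)`, conjugation by the reflection `refl`; its
`+1` eigenspace is the Lie algebra `so(1, l-1)` of `H`. -/
def sigma (m : ℕ) : so m →ₗ[ℝ] so m where
  toFun X := ⟨refl m * (X : Matrix (Idx m) (Idx m) ℝ) * refl m, by
    have hX := (mem_so_iff (X : Matrix (Idx m) (Idx m) ℝ)).1 X.2
    have ht : (refl m)ᵀ = refl m := diagonal_transpose _
    rw [mem_so_iff, transpose_mul, transpose_mul, ht]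
    calc _ = refl m * (X : Matrix (Idx m) (Idx m) ℝ)ᵀ * (refl m * eta m) := by
            simp only [Matrix.mul_assoc]
      _ = refl m * ((X : Matrix (Idx m) (Idx m) ℝ)ᵀ * eta m) * refl m := by
            rw [refl_mul_eta]; simp only [Matrix.mul_assoc]
      _ = -((refl m * eta m) * (X : Matrix (Idx m) (Idx m) ℝ) * refl m) := by
            rw [hX]; simp only [Matrix.mul_assoc, Matrix.mul_neg, Matrix.neg_mul]
      _ = _ := by rw [refl_mul_eta]; simp only [Matrix.mul_assoc]⟩
  map_add' X Y := by
    apply Subtype.ext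
    simp [Matrix.mul_add, Matrix.add_mul]
  map_smul' c X := by
    apply Subtype.ext
    simp

/-- `𝒬`, the `-1` eigenspace of `σ`. -/
def Q (m : ℕ) : Submodule ℝ (so m) := LinearMap.ker (sigma m + LinearMap.id)

/-- The projection `pr_𝒬 X = (X - σ X) / 2` of `𝒢 = ℋ ⊕ 𝒬` onto `𝒬`. -/
def prQ (m : ℕ) : so m →ₗ[ℝ] so m := (1 / 2 : ℝ) • (LinearMap.id - sigma m)

/-- The Killing norm `‖X‖ = -B(X, X) / (2 (l-1))` on `so(2, l-1)`, with `l - 1 = m + 2`. It is a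
quadratic (indefinite) expression, without square root. -/
def killingNorm {m : ℕ} (X : so m) : ℝ :=
  -(1 / (2 * ((m : ℝ) + 2))) * killingForm ℝ (so m) X X

/-- The boost that exchanges the time-like basis vector `i` and the space-like basis vector `j`. -/
def boost {m : ℕ} (i : Fin 2) (j : Fin (m + 2)) : so m :=
  ⟨Matrix.single (Sum.inl i) (Sum.inr j) 1 + Matrix.single (Sum.inr j) (Sum.inl i) 1, by
    rw [mem_so_iff]
    unfold eta LieAlgebra.Orthogonal.indefiniteDiagonal
    ext a b
    rcases a with a | a <;> rcases b with b | b <;>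
      simp [Matrix.single_apply, Matrix.mul_diagonal, Matrix.diagonal_mul, and_comm, apply_ite]⟩

/-- `J₁ ∈ ℋ`: the boost in the plane of the second time-like and the first space-like axis. -/
def J1 (m : ℕ) : so m := boost 1 0

/-- `J₂ ∈ 𝒬`: the boost in the plane of the first time-like and the second space-like axis. -/
def J2 (m : ℕ) : so m := boost 0 1

/-! ### The Iwasawa groups `AN` and `A N̄` -/

/-- `𝒜 = ⟨J₁, J₂⟩`. -/
def algA (m : ℕ) : Submodule ℝ (so m) := Submodule.span ℝ {J1 m, J2 m}

/-- The root space of all `X` with `[J₁, X] = α X` and `[J₂, X] = β X`. -/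
def rootSpace (m : ℕ) (α β : ℝ) : Submodule ℝ (so m) where
  carrier := {X | ⁅J1 m, X⁆ = α • X ∧ ⁅J2 m, X⁆ = β • X}
  zero_mem' := by simp
  add_mem' := by
    rintro X Y ⟨h1, h2⟩ ⟨h3, h4⟩
    exact ⟨by rw [lie_add, h1, h3, smul_add], by rw [lie_add, h2, h4, smul_add]⟩
  smul_mem' := by
    rintro c X ⟨h1, h2⟩
    exact ⟨by rw [lie_smul, h1, smul_comm], by rw [lie_smul, h2, smul_comm]⟩

/-- `𝒩`, the sum of the root spaces of the positive roots `(1,0)`, `(0,1)`, `(1,1)`, `(1,-1)`. -/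
def algN (m : ℕ) : Submodule ℝ (so m) :=
  rootSpace m 1 0 ⊔ rootSpace m 0 1 ⊔ rootSpace m 1 1 ⊔ rootSpace m 1 (-1)

/-- `𝒩̄ = θ 𝒩`. -/
def algNbar (m : ℕ) : Submodule ℝ (so m) := (algN m).map (theta m)

/-- The subgroup of `G` generated by the exponentials of the elements of a subspace (for a
subalgebra, its connected Lie subgroup). -/
def expSubgroup {m : ℕ} (V : Submodule ℝ (so m)) : Subgroup (G m) :=
  Subgroup.closure (expG '' (V : Set (so m)))

/-- The Iwasawa group `AN`. -/
def AN (m : ℕ) : Subgroup (G m) := expSubgroup (algA m) ⊔ expSubgroup (algN m)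

/-- The Iwasawa group `A N̄`. -/
def ANbar (m : ℕ) : Subgroup (G m) := expSubgroup (algA m) ⊔ expSubgroup (algNbar m)

/-- The singularity `𝒮`: the union of the closed orbits of `AN` and of the closed orbits of
`A N̄` in `AdS_l`. -/
def singularity (m : ℕ) : Set (AdS m) :=
  ⋃₀ {O | IsClosed O ∧
    ((∃ p : AdS m, O = MulAction.orbit (AN m) p) ∨ ∃ p : AdS m, O = MulAction.orbit (ANbar m) p)}

/-! ### Tangent vectors of `AdS_l`, the induced norm and fundamental vector fields -/

/-- Smooth functions on `G/H`: those `f` for which `f ∘ π` is smooth on `G`, i.e. (`G` being a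
closed submanifold of the space of matrices) the restriction of a smooth function of the matrix
entries. -/
def SmoothFun (m : ℕ) : Type :=
  {f : AdS m → ℝ // ∃ F : (Idx m → Idx m → ℝ) → ℝ, ContDiff ℝ ((⊤ : ℕ∞) : WithTop ℕ∞) F ∧
    ∀ g : G m, f (proj g) = F (fun i j => toMat g i j)}

/-- The velocity at time `0` of a curve in `AdS_l`, as the operator `f ↦ d/dt f(γ(t))|_{t=0}` on
smooth functions. Tangent vectors of `AdS_l` are regarded as such operators. -/
def velocity {m : ℕ} (γ : ℝ → AdS m) : SmoothFun m → ℝ :=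
  fun f => deriv (fun t => f.1 (γ t)) 0

/-- `dπ_g dL_g X`, the velocity of `t ↦ π(g e^{tX})`, a tangent vector at `[g]`. -/
def leftTangent {m : ℕ} (g : G m) (X : so m) : SmoothFun m → ℝ :=
  velocity fun t => proj (g * expG (t • X))

open Classical in
/-- The norm on the tangent space at `p` induced by the Killing form: a tangent vector at
`p = [g]` is `dπ_g dL_g X` for one `X ∈ 𝒬`, and its norm is `‖X‖`. (The value does not depend on
the representative `g`; operators that are not tangent vectors at `p` get the value `0`.) -/
def tangentNorm {m : ℕ} (p : AdS m) (v : SmoothFun m → ℝ) : ℝ :=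
  if h : ∃ X : so m, X ∈ Q m ∧ ∃ g : G m, proj g = p ∧ v = leftTangent g X then
    killingNorm h.choose
  else 0

/-- The fundamental vector field `X*_p = d/dt (e^{-tX} · p)|_{t=0}` of the action of `G`. -/
def fundamentalField {m : ℕ} (X : so m) (p : AdS m) : SmoothFun m → ℝ :=
  velocity fun t => expG (-(t • X)) • p

end BTZ

end

noncomputable section

namespace BTZ

open Matrix

attribute [local instance 100] LieRing.ofAssociativeRing

/-! ### The matrix exponential acting on vectors -/

section Exponential

variable {ι : Type*} [Fintype ι] [DecidableEq ι]

/-! Everything is transported to the quadric ⟨v, v⟩ = 1 by the embedding [g] ↦ v = g e_u. For X in 𝒬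
the Killing norm equals ⟨X e_u, X e_u⟩ (`killingNorm_of_mem_Q`, resting on `killingForm_so`), and
projecting onto 𝒬 does not change X e_u. Since g is an isometry, the norm of J₁* at [g] is ⟨J₁ v, J₁
v⟩ = x₁² - t² (`killingNorm_prQ_Ad_J1`). It remains to show that the singularity is the locus t =
±x₁.

AN multiplies t - x₁ by positive factors and, on the hyperplane t = x₁, does the same to u - x₂
(`AN_le_flagSubgroup`). On that hyperplane u - x₂ cannot vanish, because ⟨v, v⟩ would be
nonpositive. Explicit elements of AN move every point of it to ±e_u, so the orbit is cut out by t =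
x₁ and a weak sign condition on u - x₂, hence closed (`isClosed_orbit_AN`).

If t ≠ x₁, N moves the point to one with t + x₁ = 0 and u - x₂ = 1. There the flow of J₁ contracts
the component along e_t - e_{x₁}; the limit still lies in AdS, because the same ray is traced by the
one-parameter group of a root vector outside 𝒩, but it satisfies t = x₁, so the orbit is not closed
(`coordT_emb_eq_zero_of_isClosed`).

Finally, a diagonal element of G conjugates AN to A N̄ and exchanges t - x₁ with t + x₁, so the
closed orbits of A N̄ fill t = -x₁ (`isClosed_orbit_ANbar_iff`). -/

theorem hasSum_linear_exp_mulVec (X : Matrix ι ι ℝ) (v : ι → ℝ) (φ : (ι → ℝ) →ₗ[ℝ] ℝ) :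
    HasSum (fun n : ℕ => (n.factorial : ℝ)⁻¹ * φ (X ^ n *ᵥ v)) (φ (NormedSpace.exp X *ᵥ v)) := by
  have h : HasSum (fun n : ℕ => (n.factorial : ℝ)⁻¹ • X ^ n) (NormedSpace.exp X) := by
    open scoped Norms.Operator in exact NormedSpace.exp_series_hasSum_exp' (𝕂 := ℝ) X
  let T : Matrix ι ι ℝ →ₗ[ℝ] ℝ := φ ∘ₗ (Matrix.mulVecBilin ℝ ℝ).flip v
  have hT : Continuous T := LinearMap.continuous_of_finiteDimensional T
  have h2 := h.map T hT
  convert! h2 using 1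
  funext n
  simp [T]

/-- Stated for a functional along the powers applied to one vector, since u - x₂ is an
eigenfunctional only on vectors with t = x₁. -/
theorem linear_exp_mulVec_of_eigen {X : Matrix ι ι ℝ} {v : ι → ℝ} {φ : (ι → ℝ) →ₗ[ℝ] ℝ} {c : ℝ}
    (h : ∀ n : ℕ, φ (X ^ n *ᵥ v) = c ^ n * φ v) :
    φ (NormedSpace.exp X *ᵥ v) = Real.exp c * φ v := by
  have h1 := hasSum_linear_exp_mulVec X v φ
  have h2 : HasSum (fun n : ℕ => c ^ n / n.factorial) (Real.exp c) := by
    rw [Real.exp_eq_exp_ℝ]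
    exact NormedSpace.expSeries_div_hasSum_exp c
  refine h1.unique ?_
  convert! h2.mul_right (φ v) using 1
  funext n
  rw [h]
  ring

theorem exp_mulVec_of_eigen {X : Matrix ι ι ℝ} {v : ι → ℝ} {c : ℝ} (h : X *ᵥ v = c • v) :
    NormedSpace.exp X *ᵥ v = Real.exp c • v := by
  have hp : ∀ n : ℕ, X ^ n *ᵥ v = c ^ n • v := by
    intro n
    induction n with
    | zero => simp
    | succ n ih => rw [pow_succ, ← mulVec_mulVec, h, mulVec_smul, ih, smul_smul, pow_succ, mul_comm]
  funext i
  have := linear_exp_mulVec_of_eigen (X := X) (v := v) (φ := LinearMap.proj i) (c := c)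
    (fun n => by rw [hp]; simp)
  simpa using this

theorem exp_mulVec_of_cube_eq_zero {X : Matrix ι ι ℝ} {v : ι → ℝ}
    (h : X *ᵥ (X *ᵥ (X *ᵥ v)) = 0) :
    NormedSpace.exp X *ᵥ v = v + X *ᵥ v + (1 / 2 : ℝ) • (X *ᵥ (X *ᵥ v)) := by
  have hp : ∀ n : ℕ, X ^ (n + 3) *ᵥ v = 0 := by
    intro n
    rw [pow_add, ← mulVec_mulVec, pow_succ, pow_two, ← mulVec_mulVec, ← mulVec_mulVec, h,
      mulVec_zero]
  funext i
  have h1 := hasSum_linear_exp_mulVec X v (LinearMap.proj i)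
  have h2 := hasSum_sum_of_ne_finset_zero (L := .unconditional ℕ) (s := Finset.range 3)
    (f := fun n : ℕ => (n.factorial : ℝ)⁻¹ * (LinearMap.proj i : (ι → ℝ) →ₗ[ℝ] ℝ) (X ^ n *ᵥ v))
    (fun n hn => by
      obtain ⟨k, rfl⟩ := Nat.exists_eq_add_of_le (Finset.mem_range.not.1 hn |> not_lt.1)
      simp [add_comm 3 k, hp])
  have h3 := h1.unique h2
  simp only [LinearMap.coe_proj, Function.eval, Finset.sum_range_succ, Finset.range_zero,
    Finset.sum_empty] at h3
  rw [h3]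
  simp [pow_two, mulVec_mulVec, Nat.factorial]

theorem exp_mulVec_of_sq_eq_zero {X : Matrix ι ι ℝ} {v : ι → ℝ}
    (h : X *ᵥ (X *ᵥ v) = 0) : NormedSpace.exp X *ᵥ v = v + X *ᵥ v := by
  rw [exp_mulVec_of_cube_eq_zero (by rw [h, mulVec_zero]), h, smul_zero, add_zero]

theorem hasDerivAt_exp_smul_apply (X : Matrix ι ι ℝ) (i j : ι) :
    HasDerivAt (fun t : ℝ => NormedSpace.exp (t • X) i j) (X i j) 0 := by
  open scoped Norms.Operator in
  exact HasFDerivAt.comp_hasDerivAt (0 : ℝ)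
    (LinearMap.toContinuousLinearMap (Matrix.entryLinearMap ℝ ℝ i j)).hasFDerivAt
    (by
      have h := hasDerivAt_exp_smul_const (𝕂 := ℝ) X 0
      rw [zero_smul, NormedSpace.exp_zero, one_mul] at h
      exact h)

theorem continuous_exp_smul (X : Matrix ι ι ℝ) :
    Continuous fun t : ℝ => NormedSpace.exp (t • X) := by
  open scoped Norms.Operator in
  exact (differentiable_exp_smul_const ℝ X).continuous

end Exponential

/-! ### The trace of linear maps on matrices and the Killing form of `so(2, l-1)` -/

section Trace

variable {ι : Type*} [Fintype ι] [DecidableEq ι]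

theorem trace_matrix_end (f : Matrix ι ι ℝ →ₗ[ℝ] Matrix ι ι ℝ) :
    LinearMap.trace ℝ _ f = ∑ i, ∑ j, f (Matrix.single i j 1) i j := by
  rw [LinearMap.trace_eq_matrix_trace ℝ (Matrix.stdBasis ℝ ι ι), Matrix.trace, Fintype.sum_prod_type]
  refine Finset.sum_congr rfl fun i _ => Finset.sum_congr rfl fun j _ => ?_
  rw [diag_apply, LinearMap.toMatrix_apply, Matrix.stdBasis_eq_single]
  rfl

/-- With `trace_matrix_end`, this sum is the trace of Y ↦ A Y B, and the next one that of Y ↦ A Yᵀ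
B. -/
theorem sum_mul_single_mul (A B : Matrix ι ι ℝ) :
    ∑ i, ∑ j, (A * Matrix.single i j 1 * B : Matrix ι ι ℝ) i j = A.trace * B.trace := by
  simp [Matrix.mul_apply, Matrix.single_apply, Matrix.trace, Finset.sum_mul_sum, ite_and]

theorem sum_mul_single_swap_mul (A B : Matrix ι ι ℝ) :
    ∑ i, ∑ j, (A * Matrix.single j i 1 * B : Matrix ι ι ℝ) i j = (A * Bᵀ).trace := by
  simp [Matrix.mul_apply, Matrix.single_apply, Matrix.trace, ite_and]

end Trace

variable {m : ℕ}

theorem eta_transpose : (eta m)ᵀ = eta m := diagonal_transpose _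

theorem eta_mul_transpose_mul_eta (X : so m) :
    eta m * (X : Matrix (Idx m) (Idx m) ℝ)ᵀ * eta m = -(X : Matrix (Idx m) (Idx m) ℝ) := by
  rw [Matrix.mul_assoc, (mem_so_iff _).1 X.2, Matrix.mul_neg, ← Matrix.mul_assoc, eta_mul_eta,
    Matrix.one_mul]

/-- The projection `Y ↦ (Y - η Yᵀ η) / 2` of the space of matrices onto `so(2, l-1)`. -/
def soProj (m : ℕ) : Matrix (Idx m) (Idx m) ℝ →ₗ[ℝ] so m where
  toFun Y := ⟨(1 / 2 : ℝ) • (Y - eta m * Yᵀ * eta m), by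
    rw [mem_so_iff]
    simp only [transpose_smul, transpose_sub, transpose_mul, transpose_transpose, eta_transpose,
      Matrix.smul_mul, Matrix.mul_smul, Matrix.sub_mul, Matrix.mul_sub, Matrix.mul_assoc,
      eta_mul_eta, Matrix.mul_one]
    simp only [← Matrix.mul_assoc, eta_mul_eta, Matrix.one_mul]
    rw [← smul_neg, neg_sub]⟩
  map_add' X Y := by
    apply Subtype.ext
    change (1 / 2 : ℝ) • (X + Y - eta m * (X + Y)ᵀ * eta m) =
      (1 / 2 : ℝ) • (X - eta m * Xᵀ * eta m) + (1 / 2 : ℝ) • (Y - eta m * Yᵀ * eta m)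
    rw [transpose_add, Matrix.mul_add, Matrix.add_mul, ← smul_add]
    congr 1
    abel
  map_smul' c X := by
    apply Subtype.ext
    change (1 / 2 : ℝ) • (c • X - eta m * (c • X)ᵀ * eta m) =
      c • (1 / 2 : ℝ) • (X - eta m * Xᵀ * eta m)
    rw [transpose_smul, Matrix.mul_smul, Matrix.smul_mul, ← smul_sub, smul_comm]

theorem coe_soProj (Y : Matrix (Idx m) (Idx m) ℝ) :
    (soProj m Y : Matrix (Idx m) (Idx m) ℝ) = (1 / 2 : ℝ) • (Y - eta m * Yᵀ * eta m) := rfl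

theorem soProj_coe (X : so m) : soProj m (X : Matrix (Idx m) (Idx m) ℝ) = X := by
  apply Subtype.ext
  rw [coe_soProj, eta_mul_transpose_mul_eta, sub_neg_eq_add, ← two_smul ℝ, smul_smul]
  norm_num

theorem coe_lie (X Y : so m) : ((⁅X, Y⁆ : so m) : Matrix (Idx m) (Idx m) ℝ) =
    (X : Matrix (Idx m) (Idx m) ℝ) * Y - (Y : Matrix (Idx m) (Idx m) ℝ) * X := rfl

theorem trace_so (X : so m) : (X : Matrix (Idx m) (Idx m) ℝ).trace = 0 := by
  have h := congrArg trace (eta_mul_transpose_mul_eta X)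
  rw [trace_mul_comm, ← Matrix.mul_assoc, eta_mul_eta, Matrix.one_mul, trace_transpose,
    trace_neg] at h
  linarith

/-- The Killing form of `so(2, l-1)` is `(l - 1)` times the trace form. -/
theorem killingForm_so (X : so m) : killingForm ℝ (so m) X X =
    ((m : ℝ) + 2) * ((X : Matrix (Idx m) (Idx m) ℝ) * X).trace := by
  set M := (X : Matrix (Idx m) (Idx m) ℝ) with hM
  set i : so m →ₗ[ℝ] Matrix (Idx m) (Idx m) ℝ := (so m).toSubmodule.subtype with hi
  have hpi : soProj m ∘ₗ i = LinearMap.id := LinearMap.ext soProj_coe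
  set T := LieAlgebra.ad ℝ (so m) X ∘ₗ LieAlgebra.ad ℝ (so m) X with hT
  -- Cyclicity of the trace and p ∘ i = id move the computation from so(2, l-1) to the full matrix
  -- space, which has the basis of matrix units.
  have h1 : killingForm ℝ (so m) X X = LinearMap.trace ℝ _ ((i ∘ₗ T) ∘ₗ soProj m) := by
    rw [← LinearMap.trace_comp_comm' (i ∘ₗ T) (soProj m), ← LinearMap.comp_assoc, hpi,
      LinearMap.id_comp]
    exact killingForm_apply_apply ℝ (so m) X X
  have h2 : ∀ Y, ((i ∘ₗ T) ∘ₗ soProj m) Y = (1 / 2 : ℝ) •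
      ((M * M * Y * 1 - (2 : ℝ) • (M * Y * M) + 1 * Y * (M * M)) -
      ((M * M * eta m) * Yᵀ * eta m - (2 : ℝ) • ((M * eta m) * Yᵀ * (eta m * M)) +
        eta m * Yᵀ * (eta m * (M * M)))) := by
    intro Y
    have : ((i ∘ₗ T) ∘ₗ soProj m) Y = M * (M * (soProj m Y : Matrix (Idx m) (Idx m) ℝ) -
      (soProj m Y : Matrix (Idx m) (Idx m) ℝ) * M) - (M * (soProj m Y : Matrix (Idx m) (Idx m) ℝ) -
      (soProj m Y : Matrix (Idx m) (Idx m) ℝ) * M) * M := rfl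
    rw [this, coe_soProj]
    simp only [Matrix.mul_smul, Matrix.smul_mul, ← smul_sub, Matrix.mul_one, Matrix.one_mul]
    congr 1
    rw [two_smul, two_smul]
    noncomm_ring
  rw [h1, trace_matrix_end]
  simp only [h2, transpose_single, Matrix.smul_apply, Matrix.sub_apply, Matrix.add_apply,
    smul_eq_mul, ← Finset.mul_sum, Finset.sum_add_distrib, Finset.sum_sub_distrib,
    sum_mul_single_mul, sum_mul_single_swap_mul, transpose_mul, eta_transpose]
  have hX := eta_mul_transpose_mul_eta X
  rw [← hM] at hX
  -- The transposed terms contribute 4 tr M² in all, the others 2(m + 4) tr M² - 2 (tr M)² with tr M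
  -- = 0; half the difference is (m + 2) tr M².
  have e1 : (M * M * eta m * eta m).trace = (M * M).trace := by
    rw [Matrix.mul_assoc, eta_mul_eta, Matrix.mul_one]
  have e2 : (M * eta m * (Mᵀ * eta m)).trace = -(M * M).trace := by
    rw [Matrix.mul_assoc, ← Matrix.mul_assoc (eta m), hX, Matrix.mul_neg, trace_neg]
  have e3 : (eta m * (Mᵀ * Mᵀ * eta m)).trace = (M * M).trace := by
    rw [trace_mul_comm, Matrix.mul_assoc, eta_mul_eta, Matrix.mul_one, ← transpose_mul,
      trace_transpose]
  have e4 : M.trace = 0 := trace_so X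
  rw [e1, e2, e3, e4, trace_one]
  simp
  ring

/-! ### The invariant form and the embedding of `AdS_l` as a quadric -/

/-- The bilinear form of signature `(2, l-1)` defined by `η`. -/
def ip (v w : Idx m → ℝ) : ℝ := (eta m *ᵥ v) ⬝ᵥ w

theorem ip_eq (v w : Idx m → ℝ) : ip v w =
    v (Sum.inl 0) * w (Sum.inl 0) + v (Sum.inl 1) * w (Sum.inl 1) -
      ∑ j, v (Sum.inr j) * w (Sum.inr j) := by
  unfold ip eta LieAlgebra.Orthogonal.indefiniteDiagonal
  simp [dotProduct, mulVec_diagonal, Fintype.sum_sum_type, Fin.sum_univ_two, sub_eq_add_neg]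

theorem ip_toMat (g : G m) (v w : Idx m → ℝ) : ip (toMat g *ᵥ v) (toMat g *ᵥ w) = ip v w := by
  have hg : (toMat g)ᵀ * eta m * toMat g = eta m := g.2
  unfold ip
  rw [dotProduct_mulVec, ← mulVec_transpose, mulVec_mulVec, mulVec_mulVec, hg]

theorem toMat_mul_inv (g : G m) : toMat g * toMat g⁻¹ = 1 := by
  rw [← toMat_mul, mul_inv_cancel, toMat_one]

theorem toMat_inv_mul (g : G m) : toMat g⁻¹ * toMat g = 1 := by
  rw [← toMat_mul, inv_mul_cancel, toMat_one]

theorem toMat_expG (X : so m) :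
    toMat (expG X) = NormedSpace.exp (X : Matrix (Idx m) (Idx m) ℝ) := rfl

theorem G_ext {g h : G m} (H : toMat g = toMat h) : g = h := Subtype.ext (Subtype.ext H)

theorem proj_eq_proj_iff {g h : G m} :
    proj g = proj h ↔ toMat g *ᵥ baseVec m = toMat h *ᵥ baseVec m := by
  have h1 : proj g = proj h ↔ toMat (g⁻¹ * h) *ᵥ baseVec m = baseVec m := QuotientGroup.eq
  rw [h1, toMat_mul, ← mulVec_mulVec]
  constructor
  · intro h2
    rw [← h2, mulVec_mulVec, toMat_mul_inv, one_mulVec, h2]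
  · intro h2
    rw [← h2, mulVec_mulVec, toMat_inv_mul, one_mulVec]

theorem proj_surjective : Function.Surjective (proj : G m → AdS m) := QuotientGroup.mk_surjective

theorem smul_proj (g h : G m) : g • proj h = proj (g * h) := rfl

/-- The embedding `[g] ↦ g e_u` of `AdS_l` into `ℝ^{2,l-1}`. -/
def emb : AdS m → Idx m → ℝ :=
  Quotient.lift (fun g : G m => toMat g *ᵥ baseVec m)
    fun _ _ h => proj_eq_proj_iff.1 (Quotient.sound h)

theorem emb_proj (g : G m) : emb (proj g) = toMat g *ᵥ baseVec m := rfl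

/-- Surjectivity onto the quadric is never needed: points of AdS are always produced by acting with
elements of G. -/
theorem emb_injective : Function.Injective (emb : AdS m → Idx m → ℝ) := by
  intro p q h
  obtain ⟨g, rfl⟩ := proj_surjective p
  obtain ⟨k, rfl⟩ := proj_surjective q
  exact proj_eq_proj_iff.2 h

theorem emb_smul (g : G m) (p : AdS m) : emb (g • p) = toMat g *ᵥ emb p := by
  obtain ⟨k, rfl⟩ := proj_surjective p
  rw [smul_proj, emb_proj, emb_proj, toMat_mul, mulVec_mulVec]

theorem ip_baseVec : ip (baseVec m) (baseVec m) = 1 := by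
  rw [ip_eq]
  simp [baseVec]

theorem ip_emb (p : AdS m) : ip (emb p) (emb p) = 1 := by
  obtain ⟨k, rfl⟩ := proj_surjective p
  rw [emb_proj, ip_toMat, ip_baseVec]

theorem continuous_toMat : Continuous (toMat : G m → Matrix (Idx m) (Idx m) ℝ) :=
  continuous_subtype_val.comp continuous_subtype_val

theorem continuous_emb : Continuous (emb : AdS m → Idx m → ℝ) :=
  Continuous.quotient_lift (continuous_toMat.matrix_mulVec continuous_const) _

/-! ### The Killing norm on `𝒬` -/

theorem so_apply (X : so m) (i j : Idx m) :
    (X : Matrix (Idx m) (Idx m) ℝ) j i * eta m j j = -(eta m i i *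
      (X : Matrix (Idx m) (Idx m) ℝ) i j) := by
  have h := congrFun (congrFun ((mem_so_iff _).1 X.2) i) j
  unfold eta LieAlgebra.Orthogonal.indefiniteDiagonal at h ⊢
  rw [Matrix.mul_diagonal, Matrix.neg_apply, Matrix.diagonal_mul] at h
  rw [diagonal_apply_eq, diagonal_apply_eq]
  exact h

theorem so_apply_self (X : so m) (i : Fin 2) :
    (X : Matrix (Idx m) (Idx m) ℝ) (Sum.inl i) (Sum.inl i) = 0 := by
  have h := so_apply X (Sum.inl i) (Sum.inl i)
  simp [LieAlgebra.Orthogonal.indefiniteDiagonal] at h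
  linarith

theorem mulVec_baseVec (X : Matrix (Idx m) (Idx m) ℝ) (i : Idx m) :
    (X *ᵥ baseVec m) i = X i (Sum.inl 0) := by
  simp [baseVec]

theorem coe_sigma (X : so m) : (sigma m X : Matrix (Idx m) (Idx m) ℝ) =
    refl m * (X : Matrix (Idx m) (Idx m) ℝ) * refl m := rfl

theorem sigma_apply (X : so m) (i j : Idx m) : (sigma m X : Matrix (Idx m) (Idx m) ℝ) i j =
    (if i = Sum.inl 0 then -1 else 1) * (X : Matrix (Idx m) (Idx m) ℝ) i j *
      (if j = Sum.inl 0 then -1 else 1) := by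
  rw [coe_sigma, refl, Matrix.mul_diagonal, Matrix.diagonal_mul]

theorem sigma_sigma (X : so m) : sigma m (sigma m X) = X := by
  apply Subtype.ext
  ext i j
  rw [sigma_apply, sigma_apply]
  split_ifs <;> ring

theorem mem_Q_iff (X : so m) : X ∈ Q m ↔ sigma m X = -X := by
  rw [Q, LinearMap.mem_ker, LinearMap.add_apply, LinearMap.id_apply, add_eq_zero_iff_eq_neg]

theorem prQ_apply (X : so m) : prQ m X = (1 / 2 : ℝ) • (X - sigma m X) := rfl

theorem prQ_mem_Q (X : so m) : prQ m X ∈ Q m := by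
  rw [mem_Q_iff, prQ_apply, map_smul, map_sub, sigma_sigma, ← smul_neg, neg_sub]

theorem coe_prQ_apply (X : so m) (i j : Idx m) : (prQ m X : Matrix (Idx m) (Idx m) ℝ) i j =
    1 / 2 * ((X : Matrix (Idx m) (Idx m) ℝ) i j -
      (sigma m X : Matrix (Idx m) (Idx m) ℝ) i j) := rfl

/-- σ negates the first column off the diagonal, so the projection keeps it; the diagonal entry is
zero in so(2, l-1). -/
theorem prQ_mulVec_baseVec (X : so m) : (prQ m X : Matrix (Idx m) (Idx m) ℝ) *ᵥ baseVec m =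
    (X : Matrix (Idx m) (Idx m) ℝ) *ᵥ baseVec m := by
  funext i
  rw [mulVec_baseVec, mulVec_baseVec, coe_prQ_apply, sigma_apply]
  by_cases hi : i = Sum.inl 0
  · subst hi
    rw [so_apply_self]
    ring
  · rw [if_neg hi, if_pos rfl]
    ring

theorem killingNorm_eq_trace (X : so m) :
    killingNorm X = -(1 / 2) * ((X : Matrix (Idx m) (Idx m) ℝ) * X).trace := by
  rw [killingNorm, killingForm_so]
  have : (m : ℝ) + 2 ≠ 0 := by positivity
  field_simp

/-- On `𝒬`, the Killing norm of `X` is the square of the vector `X e_u`. -/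
theorem killingNorm_of_mem_Q {X : so m} (hX : X ∈ Q m) : killingNorm X =
    ip ((X : Matrix (Idx m) (Idx m) ℝ) *ᵥ baseVec m)
      ((X : Matrix (Idx m) (Idx m) ℝ) *ᵥ baseVec m) := by
  rw [mem_Q_iff] at hX
  have hq : ∀ i j, (if i = Sum.inl 0 then -1 else 1) * (X : Matrix (Idx m) (Idx m) ℝ) i j *
      (if j = Sum.inl 0 then -1 else 1) = -(X : Matrix (Idx m) (Idx m) ℝ) i j := by
    intro i j
    rw [← sigma_apply, hX]
    rfl
  have hz : ∀ i j, i ≠ Sum.inl 0 → j ≠ Sum.inl 0 → (X : Matrix (Idx m) (Idx m) ℝ) i j = 0 := by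
    intro i j hi hj
    have := hq i j
    rw [if_neg hi, if_neg hj] at this
    linarith
  have h1 : ∀ i j, (X : Matrix (Idx m) (Idx m) ℝ) (Sum.inr i) (Sum.inr j) = 0 :=
    fun i j => hz _ _ (by simp) (by simp)
  have h2 : ∀ j, (X : Matrix (Idx m) (Idx m) ℝ) (Sum.inl 1) (Sum.inr j) = 0 :=
    fun j => hz _ _ (by simp) (by simp)
  have h3 : ∀ j, (X : Matrix (Idx m) (Idx m) ℝ) (Sum.inr j) (Sum.inl 1) = 0 :=
    fun j => hz _ _ (by simp) (by simp)
  have h4 : (X : Matrix (Idx m) (Idx m) ℝ) (Sum.inl 0) (Sum.inl 1) =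
      -(X : Matrix (Idx m) (Idx m) ℝ) (Sum.inl 1) (Sum.inl 0) := by
    have := so_apply X (Sum.inl 0) (Sum.inl 1)
    simp [LieAlgebra.Orthogonal.indefiniteDiagonal] at this
    linarith
  have h5 : ∀ j, (X : Matrix (Idx m) (Idx m) ℝ) (Sum.inl 0) (Sum.inr j) =
      (X : Matrix (Idx m) (Idx m) ℝ) (Sum.inr j) (Sum.inl 0) := by
    intro j
    have := so_apply X (Sum.inl 0) (Sum.inr j)
    simp [LieAlgebra.Orthogonal.indefiniteDiagonal] at this
    linarith
  rw [killingNorm_eq_trace, ip_eq]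
  simp only [Matrix.trace, diag_apply, Matrix.mul_apply, Fintype.sum_sum_type, Fin.sum_univ_two,
    h1, h2, h3, h4, h5, so_apply_self, mulVec_baseVec, mul_zero, add_zero, zero_add,
    Finset.sum_const_zero]
  ring

/-! ### Tangent vectors -/

theorem hasDerivAt_toMat_mul_expG (g : G m) (X : so m) :
    HasDerivAt (fun t : ℝ => fun i j => toMat (g * expG (t • X)) i j)
      (fun i j => (toMat g * (X : Matrix (Idx m) (Idx m) ℝ)) i j) 0 := by
  refine hasDerivAt_pi.2 fun i => hasDerivAt_pi.2 fun j => ?_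
  change HasDerivAt (fun t : ℝ => ∑ k, toMat g i k *
    NormedSpace.exp (t • (X : Matrix (Idx m) (Idx m) ℝ)) k j)
    (∑ k, toMat g i k * (X : Matrix (Idx m) (Idx m) ℝ) k j) 0
  exact HasDerivAt.fun_sum fun k _ => (hasDerivAt_exp_smul_apply _ k j).const_mul _

theorem expG_zero : expG (0 : so m) = 1 := by
  apply G_ext
  rw [toMat_expG, toMat_one]
  exact NormedSpace.exp_zero

/-- The chain rule for an extension of f ∘ π to all matrices; it makes the tangent vector additive
in X. -/
theorem leftTangent_eq_fderiv (g : G m) (X : so m) (f : SmoothFun m)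
    {F : (Idx m → Idx m → ℝ) → ℝ} (hF : ContDiff ℝ ((⊤ : ℕ∞) : WithTop ℕ∞) F)
    (hf : ∀ g : G m, f.1 (proj g) = F (fun i j => toMat g i j)) :
    leftTangent g X f = fderiv ℝ F (fun i j => toMat g i j)
      (fun i j => (toMat g * (X : Matrix (Idx m) (Idx m) ℝ)) i j) := by
  have h1 : HasFDerivAt F (fderiv ℝ F (fun i j => toMat g i j)) (fun i j => toMat g i j) :=
    (hF.differentiable (by simp) _).hasFDerivAt
  have h2 := h1.comp_hasDerivAt_of_eq (0 : ℝ) (hasDerivAt_toMat_mul_expG g X)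
    (by rw [zero_smul, expG_zero, mul_one])
  rw [leftTangent, velocity]
  simp only [hf]
  exact h2.deriv

theorem leftTangent_add (g : G m) (X Y : so m) :
    leftTangent g (X + Y) = leftTangent g X + leftTangent g Y := by
  funext f
  obtain ⟨F, hF, hf⟩ := f.2
  rw [Pi.add_apply, leftTangent_eq_fderiv g _ f hF hf, leftTangent_eq_fderiv g _ f hF hf,
    leftTangent_eq_fderiv g _ f hF hf, ← map_add]
  congr 1
  funext i j
  change (toMat g * ((X : Matrix (Idx m) (Idx m) ℝ) + Y)) i j = _
  rw [Matrix.mul_add]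
  rfl

/-- Such an X exponentiates into H, so the curve is constant. -/
theorem leftTangent_eq_zero (g : G m) {X : so m}
    (hX : (X : Matrix (Idx m) (Idx m) ℝ) *ᵥ baseVec m = 0) : leftTangent g X = 0 := by
  have h : ∀ t : ℝ, proj (g * expG (t • X)) = proj g := by
    intro t
    rw [proj_eq_proj_iff, toMat_mul, ← mulVec_mulVec, toMat_expG]
    have h0 : ((t • X : so m) : Matrix (Idx m) (Idx m) ℝ) *ᵥ baseVec m = 0 := by
      change (t • (X : Matrix (Idx m) (Idx m) ℝ)) *ᵥ baseVec m = 0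
      rw [Matrix.smul_mulVec, hX, smul_zero]
    rw [exp_mulVec_of_sq_eq_zero (by rw [h0, mulVec_zero]), h0, add_zero]
  funext f
  rw [leftTangent, velocity]
  simp [h]

theorem leftTangent_prQ (g : G m) (X : so m) : leftTangent g (prQ m X) = leftTangent g X := by
  have h : leftTangent g (X - prQ m X) = 0 := by
    apply leftTangent_eq_zero
    change ((X : Matrix (Idx m) (Idx m) ℝ) - (prQ m X : Matrix (Idx m) (Idx m) ℝ)) *ᵥ _ = 0
    rw [sub_mulVec, prQ_mulVec_baseVec, sub_self]
  have h2 := leftTangent_add g (prQ m X) (X - prQ m X)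
  rw [h, add_zero, add_sub_cancel] at h2
  exact h2.symm

/-! ### The fundamental field as a left tangent vector, and its norm -/

theorem coe_Ad (g : G m) (X : so m) : (Ad g X : Matrix (Idx m) (Idx m) ℝ) =
    toMat g * (X : Matrix (Idx m) (Idx m) ℝ) * toMat g⁻¹ := rfl

theorem expG_Ad (g : G m) (X : so m) : expG (Ad g X) = g * expG X * g⁻¹ := by
  apply G_ext
  have hinv : (toMat g)⁻¹ = toMat g⁻¹ := Matrix.inv_eq_right_inv (toMat_mul_inv g)
  rw [toMat_mul, toMat_mul, toMat_expG, toMat_expG, coe_Ad, ← hinv]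
  exact Matrix.exp_conj _ _ ⟨⟨toMat g, toMat g⁻¹, toMat_mul_inv g, toMat_inv_mul g⟩, rfl⟩

theorem Ad_smul (g : G m) (c : ℝ) (X : so m) : Ad g (c • X) = c • Ad g X := by
  apply Subtype.ext
  change toMat g * (c • (X : Matrix (Idx m) (Idx m) ℝ)) * toMat g⁻¹ =
    c • (toMat g * (X : Matrix (Idx m) (Idx m) ℝ) * toMat g⁻¹)
  rw [Matrix.mul_smul, Matrix.smul_mul]

/-- Rewrite e^{-tX} g as g (g⁻¹ e^{-tX} g); the sign in the definition of the field survives as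
-Ad(g⁻¹)X. -/
theorem fundamentalField_proj (g : G m) (X : so m) :
    fundamentalField X (proj g) = leftTangent g (-Ad g⁻¹ X) := by
  unfold fundamentalField leftTangent
  congr 1
  funext t
  have h : t • -Ad g⁻¹ X = Ad g⁻¹ (-(t • X)) := by
    rw [smul_neg, ← neg_smul, ← neg_smul, Ad_smul]
  rw [h, expG_Ad, smul_proj, inv_inv]
  congr 1
  group

/-- The coordinate functions of the embedding are smooth. -/
def coordFun (i : Idx m) : SmoothFun m :=
  ⟨fun p => emb p i, fun A => A i (Sum.inl 0), by fun_prop, fun g => mulVec_baseVec _ i⟩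

theorem leftTangent_coordFun (g : G m) (X : so m) (i : Idx m) : leftTangent g X (coordFun i) =
    (toMat g *ᵥ ((X : Matrix (Idx m) (Idx m) ℝ) *ᵥ baseVec m)) i := by
  rw [mulVec_mulVec, mulVec_baseVec, leftTangent, velocity]
  have h := hasDerivAt_pi.1 (hasDerivAt_pi.1 (hasDerivAt_toMat_mul_expG g X) i) (Sum.inl 0)
  rw [← h.deriv]
  congr 1
  funext t
  exact mulVec_baseVec _ i

/-- The chosen representative is harmless: coordinate functions recover g X e_u from the tangent
vector, and its square does not depend on g. -/
theorem tangentNorm_leftTangent (g : G m) {X : so m} (hX : X ∈ Q m) :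
    tangentNorm (proj g) (leftTangent g X) = killingNorm X := by
  have h : ∃ Y : so m, Y ∈ Q m ∧ ∃ k : G m, proj k = proj g ∧ leftTangent g X = leftTangent k Y :=
    ⟨X, hX, g, rfl, rfl⟩
  rw [tangentNorm, dif_pos h]
  obtain ⟨hY, k, -, hk⟩ := h.choose_spec
  have hv : toMat g *ᵥ ((X : Matrix (Idx m) (Idx m) ℝ) *ᵥ baseVec m) =
      toMat k *ᵥ ((h.choose : Matrix (Idx m) (Idx m) ℝ) *ᵥ baseVec m) := by
    funext i
    rw [← leftTangent_coordFun, ← leftTangent_coordFun]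
    exact congrFun hk _
  rw [killingNorm_of_mem_Q hY, killingNorm_of_mem_Q hX, ← ip_toMat k, ← hv, ip_toMat]

theorem fundamentalField_eq_leftTangent (g : G m) (X : so m) :
    fundamentalField X (proj g) = leftTangent g (-prQ m (Ad g⁻¹ X)) := by
  rw [← map_neg, leftTangent_prQ, fundamentalField_proj]

theorem killingNorm_neg (X : so m) : killingNorm (-X) = killingNorm X := by
  simp [killingNorm]

theorem tangentNorm_fundamentalField (g : G m) (X : so m) :
    tangentNorm (proj g) (fundamentalField X (proj g)) = killingNorm (prQ m (Ad g⁻¹ X)) := by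
  rw [fundamentalField_eq_leftTangent, tangentNorm_leftTangent g ((Q m).neg_mem (prQ_mem_Q _)),
    killingNorm_neg]

theorem killingNorm_prQ_Ad (g : G m) (X : so m) : killingNorm (prQ m (Ad g⁻¹ X)) =
    ip ((X : Matrix (Idx m) (Idx m) ℝ) *ᵥ emb (proj g))
      ((X : Matrix (Idx m) (Idx m) ℝ) *ᵥ emb (proj g)) := by
  rw [killingNorm_of_mem_Q (prQ_mem_Q _), prQ_mulVec_baseVec, coe_Ad, inv_inv, ← mulVec_mulVec,
    ← mulVec_mulVec, ip_toMat, emb_proj]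

/-! ### Coordinate formulas for J₁ and J₂ -/

theorem J1_mulVec (v : Idx m → ℝ) : (J1 m : Matrix (Idx m) (Idx m) ℝ) *ᵥ v =
    Pi.single (Sum.inl 1) (v (Sum.inr 0)) + Pi.single (Sum.inr 0) (v (Sum.inl 1)) := by
  change (Matrix.single (Sum.inl 1) (Sum.inr 0) (1 : ℝ) +
    Matrix.single (Sum.inr 0) (Sum.inl 1) 1) *ᵥ v = _
  rw [add_mulVec, single_mulVec, single_mulVec, one_mul, one_mul]
  rfl

theorem J2_mulVec (v : Idx m → ℝ) : (J2 m : Matrix (Idx m) (Idx m) ℝ) *ᵥ v =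
    Pi.single (Sum.inl 0) (v (Sum.inr 1)) + Pi.single (Sum.inr 1) (v (Sum.inl 0)) := by
  change (Matrix.single (Sum.inl 0) (Sum.inr 1) (1 : ℝ) +
    Matrix.single (Sum.inr 1) (Sum.inl 0) 1) *ᵥ v = _
  rw [add_mulVec, single_mulVec, single_mulVec, one_mul, one_mul]
  rfl

theorem killingNorm_prQ_Ad_J1 (g : G m) : killingNorm (prQ m (Ad g⁻¹ (J1 m))) =
    emb (proj g) (Sum.inr 0) ^ 2 - emb (proj g) (Sum.inl 1) ^ 2 := by
  rw [killingNorm_prQ_Ad, J1_mulVec, ip_eq]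
  simp [Pi.single_apply, pow_two]

/-! ### The flag preserved by `AN` -/

/-- The coordinate `t - x₁`, a lowest weight functional for `AN`. -/
def coordT (m : ℕ) : (Idx m → ℝ) →ₗ[ℝ] ℝ :=
  (LinearMap.proj (Sum.inl 1) : (Idx m → ℝ) →ₗ[ℝ] ℝ) - LinearMap.proj (Sum.inr 0)

/-- The coordinate `u - x₂`. -/
def coordU (m : ℕ) : (Idx m → ℝ) →ₗ[ℝ] ℝ :=
  (LinearMap.proj (Sum.inl 0) : (Idx m → ℝ) →ₗ[ℝ] ℝ) - LinearMap.proj (Sum.inr 1)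

theorem coordT_apply (v : Idx m → ℝ) : coordT m v = v (Sum.inl 1) - v (Sum.inr 0) := rfl

theorem coordU_apply (v : Idx m → ℝ) : coordU m v = v (Sum.inl 0) - v (Sum.inr 1) := rfl

theorem coordT_J1 (v : Idx m → ℝ) :
    coordT m ((J1 m : Matrix (Idx m) (Idx m) ℝ) *ᵥ v) = -coordT m v := by
  simp [coordT_apply, J1_mulVec]

theorem coordT_J2 (v : Idx m → ℝ) :
    coordT m ((J2 m : Matrix (Idx m) (Idx m) ℝ) *ᵥ v) = 0 := by
  simp [coordT_apply, J2_mulVec]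

theorem coordU_J1 (v : Idx m → ℝ) :
    coordU m ((J1 m : Matrix (Idx m) (Idx m) ℝ) *ᵥ v) = 0 := by
  simp [coordU_apply, J1_mulVec]

theorem coordU_J2 (v : Idx m → ℝ) :
    coordU m ((J2 m : Matrix (Idx m) (Idx m) ℝ) *ᵥ v) = -coordU m v := by
  simp [coordU_apply, J2_mulVec]

theorem J1_J2_mulVec (v : Idx m → ℝ) : (J1 m : Matrix (Idx m) (Idx m) ℝ) *ᵥ
    ((J2 m : Matrix (Idx m) (Idx m) ℝ) *ᵥ v) = 0 := by
  simp [J1_mulVec, J2_mulVec]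

theorem J1_cube_mulVec (v : Idx m → ℝ) : (J1 m : Matrix (Idx m) (Idx m) ℝ) *ᵥ
    ((J1 m : Matrix (Idx m) (Idx m) ℝ) *ᵥ ((J1 m : Matrix (Idx m) (Idx m) ℝ) *ᵥ v)) =
    (J1 m : Matrix (Idx m) (Idx m) ℝ) *ᵥ v := by
  simp [J1_mulVec]

theorem J2_cube_mulVec (v : Idx m → ℝ) : (J2 m : Matrix (Idx m) (Idx m) ℝ) *ᵥ
    ((J2 m : Matrix (Idx m) (Idx m) ℝ) *ᵥ ((J2 m : Matrix (Idx m) (Idx m) ℝ) *ᵥ v)) =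
    (J2 m : Matrix (Idx m) (Idx m) ℝ) *ᵥ v := by
  simp [J2_mulVec]

theorem J1_sq_mulVec {v : Idx m → ℝ} (hv : coordT m v = 0) :
    (J1 m : Matrix (Idx m) (Idx m) ℝ) *ᵥ ((J1 m : Matrix (Idx m) (Idx m) ℝ) *ᵥ v) =
    (J1 m : Matrix (Idx m) (Idx m) ℝ) *ᵥ v := by
  rw [coordT_apply, sub_eq_zero] at hv
  simp [J1_mulVec, hv]

theorem mulVec_of_lie_eq_smul {Z X : so m} {c : ℝ} (h : ⁅Z, X⁆ = c • X) (v : Idx m → ℝ) :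
    (Z : Matrix (Idx m) (Idx m) ℝ) *ᵥ ((X : Matrix (Idx m) (Idx m) ℝ) *ᵥ v) =
    (X : Matrix (Idx m) (Idx m) ℝ) *ᵥ ((Z : Matrix (Idx m) (Idx m) ℝ) *ᵥ v) +
      c • ((X : Matrix (Idx m) (Idx m) ℝ) *ᵥ v) := by
  have h1 : (Z : Matrix (Idx m) (Idx m) ℝ) * X - (X : Matrix (Idx m) (Idx m) ℝ) * Z =
    c • (X : Matrix (Idx m) (Idx m) ℝ) := congrArg Subtype.val h
  rw [sub_eq_iff_eq_add] at h1
  rw [mulVec_mulVec, h1, add_mulVec, Matrix.smul_mulVec, mulVec_mulVec, add_comm]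

/-- The matrices that annihilate `t - x₁`, and annihilate `u - x₂` modulo `t - x₁`. -/
def flagNil (m : ℕ) : Submodule ℝ (so m) where
  carrier := {X | ∀ v, coordT m ((X : Matrix (Idx m) (Idx m) ℝ) *ᵥ v) = 0 ∧
    (coordT m v = 0 → coordU m ((X : Matrix (Idx m) (Idx m) ℝ) *ᵥ v) = 0)}
  zero_mem' := by
    intro v
    change coordT m ((0 : Matrix (Idx m) (Idx m) ℝ) *ᵥ v) = 0 ∧
      (_ → coordU m ((0 : Matrix (Idx m) (Idx m) ℝ) *ᵥ v) = 0)
    simp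
  add_mem' := by
    intro X Y hX hY v
    change coordT m (((X : Matrix (Idx m) (Idx m) ℝ) + (Y : Matrix (Idx m) (Idx m) ℝ)) *ᵥ v) = 0 ∧
      (_ → coordU m (((X : Matrix (Idx m) (Idx m) ℝ) + (Y : Matrix (Idx m) (Idx m) ℝ)) *ᵥ v) = 0)
    rw [add_mulVec, map_add, map_add]
    exact ⟨by rw [(hX v).1, (hY v).1, add_zero],
      fun h => by rw [(hX v).2 h, (hY v).2 h, add_zero]⟩
  smul_mem' := by
    intro c X hX v
    change coordT m ((c • (X : Matrix (Idx m) (Idx m) ℝ)) *ᵥ v) = 0 ∧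
      (_ → coordU m ((c • (X : Matrix (Idx m) (Idx m) ℝ)) *ᵥ v) = 0)
    rw [Matrix.smul_mulVec, map_smul, map_smul]
    exact ⟨by rw [(hX v).1, smul_zero], fun h => by rw [(hX v).2 h, smul_zero]⟩

/-- A root vector shifts weights: t - x₁ has weight (-1, 0) under (J₁, J₂), so its composite with X
has weight (-1 - α, -β). Likewise u - x₂ yields (-α, -1 - β). -/
theorem coordT_mulVec_J1 {X : so m} {α β : ℝ} (hX : X ∈ rootSpace m α β) (v : Idx m → ℝ) :
    coordT m ((X : Matrix (Idx m) (Idx m) ℝ) *ᵥ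
    ((J1 m : Matrix (Idx m) (Idx m) ℝ) *ᵥ v)) =
    -(1 + α) * coordT m ((X : Matrix (Idx m) (Idx m) ℝ) *ᵥ v) := by
  have h := congrArg (coordT m) (mulVec_of_lie_eq_smul hX.1 v)
  rw [coordT_J1, map_add, map_smul, smul_eq_mul] at h
  linarith

theorem coordT_mulVec_J2 {X : so m} {α β : ℝ} (hX : X ∈ rootSpace m α β) (v : Idx m → ℝ) :
    coordT m ((X : Matrix (Idx m) (Idx m) ℝ) *ᵥ
    ((J2 m : Matrix (Idx m) (Idx m) ℝ) *ᵥ v)) =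
    -β * coordT m ((X : Matrix (Idx m) (Idx m) ℝ) *ᵥ v) := by
  have h := congrArg (coordT m) (mulVec_of_lie_eq_smul hX.2 v)
  rw [coordT_J2, map_add, map_smul, smul_eq_mul] at h
  linarith

theorem coordU_mulVec_J1 {X : so m} {α β : ℝ} (hX : X ∈ rootSpace m α β) (v : Idx m → ℝ) :
    coordU m ((X : Matrix (Idx m) (Idx m) ℝ) *ᵥ
    ((J1 m : Matrix (Idx m) (Idx m) ℝ) *ᵥ v)) =
    -α * coordU m ((X : Matrix (Idx m) (Idx m) ℝ) *ᵥ v) := by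
  have h := congrArg (coordU m) (mulVec_of_lie_eq_smul hX.1 v)
  rw [coordU_J1, map_add, map_smul, smul_eq_mul] at h
  linarith

theorem coordU_mulVec_J2 {X : so m} {α β : ℝ} (hX : X ∈ rootSpace m α β) (v : Idx m → ℝ) :
    coordU m ((X : Matrix (Idx m) (Idx m) ℝ) *ᵥ
    ((J2 m : Matrix (Idx m) (Idx m) ℝ) *ᵥ v)) =
    -(1 + β) * coordU m ((X : Matrix (Idx m) (Idx m) ℝ) *ᵥ v) := by
  have h := congrArg (coordU m) (mulVec_of_lie_eq_smul hX.2 v)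
  rw [coordU_J2, map_add, map_smul, smul_eq_mul] at h
  linarith

/-- A nonzero functional of weight (λ, μ) needs λ³ = λ and λμ = 0. Here the weight has λ = -2 or
equals (-1, -1). -/
theorem coordT_mulVec_eq_zero {X : so m} {α β : ℝ}
    (hX : X ∈ rootSpace m α β) (v : Idx m → ℝ) (h : α = 1 ∨ α = 0 ∧ β = 1) :
    coordT m ((X : Matrix (Idx m) (Idx m) ℝ) *ᵥ v) = 0 := by
  rcases h with rfl | ⟨rfl, rfl⟩
  · have h := congrArg (fun w => coordT m ((X : Matrix (Idx m) (Idx m) ℝ) *ᵥ w)) (J1_cube_mulVec v)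
    simp only [coordT_mulVec_J1 hX] at h
    linarith
  · have h := congrArg (fun w => coordT m ((X : Matrix (Idx m) (Idx m) ℝ) *ᵥ w)) (J1_J2_mulVec v)
    simp only [coordT_mulVec_J1 hX, coordT_mulVec_J2 hX, mulVec_zero, map_zero] at h
    linarith

theorem coordU_mulVec_eq_zero {X : so m} {α β : ℝ}
    (hX : X ∈ rootSpace m α β) (v : Idx m → ℝ) (h : β = 1 ∨ α = 1 ∧ β = 0) :
    coordU m ((X : Matrix (Idx m) (Idx m) ℝ) *ᵥ v) = 0 := by
  rcases h with rfl | ⟨rfl, rfl⟩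
  · have h := congrArg (fun w => coordU m ((X : Matrix (Idx m) (Idx m) ℝ) *ᵥ w)) (J2_cube_mulVec v)
    simp only [coordU_mulVec_J2 hX] at h
    linarith
  · have h := congrArg (fun w => coordU m ((X : Matrix (Idx m) (Idx m) ℝ) *ᵥ w)) (J1_J2_mulVec v)
    simp only [coordU_mulVec_J1 hX, coordU_mulVec_J2 hX, mulVec_zero, map_zero] at h
    linarith

/-- Needed for the root (1, -1), where the composite has the admissible weight (-1, 0) of t - x₁
itself. On the kernel of t - x₁ one has J₁² = J₁, which excludes the J₁-weight -1. -/
theorem coordU_mulVec_eq_zero_of_coordT_eq_zero {X : so m} {α β : ℝ}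
    (hX : X ∈ rootSpace m α β) (v : Idx m → ℝ) (h : α = 1) (hv : coordT m v = 0) :
    coordU m ((X : Matrix (Idx m) (Idx m) ℝ) *ᵥ v) = 0 := by
  subst h
  have h := congrArg (fun w => coordU m ((X : Matrix (Idx m) (Idx m) ℝ) *ᵥ w)) (J1_sq_mulVec hv)
  simp only [coordU_mulVec_J1 hX] at h
  linarith

theorem algN_le_flagNil : algN m ≤ flagNil m := by
  refine sup_le (sup_le (sup_le ?_ ?_) ?_) ?_
  · exact fun X hX v => ⟨coordT_mulVec_eq_zero hX v (by simp),
      fun _ => coordU_mulVec_eq_zero hX v (by simp)⟩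
  · exact fun X hX v => ⟨coordT_mulVec_eq_zero hX v (by simp),
      fun _ => coordU_mulVec_eq_zero hX v (by simp)⟩
  · exact fun X hX v => ⟨coordT_mulVec_eq_zero hX v (by simp),
      fun _ => coordU_mulVec_eq_zero hX v (by simp)⟩
  · exact fun X hX v => ⟨coordT_mulVec_eq_zero hX v (by simp),
      coordU_mulVec_eq_zero_of_coordT_eq_zero hX v rfl⟩

/-- The elements of `G` that scale `t - x₁` by a positive factor, and `u - x₂` by a positive
factor modulo `t - x₁`. -/
def flagSubgroup (m : ℕ) : Subgroup (G m) where
  carrier := {g | ∃ a b : ℝ, 0 < a ∧ 0 < b ∧ ∀ v, coordT m (toMat g *ᵥ v) = a * coordT m v ∧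
    (coordT m v = 0 → coordU m (toMat g *ᵥ v) = b * coordU m v)}
  one_mem' := ⟨1, 1, one_pos, one_pos, fun v => by simp [toMat_one]⟩
  mul_mem' := by
    rintro g h ⟨a, b, ha, hb, hg⟩ ⟨a', b', ha', hb', hh⟩
    refine ⟨a * a', b * b', mul_pos ha ha', mul_pos hb hb', fun v => ⟨?_, fun hv => ?_⟩⟩
    · rw [toMat_mul, ← mulVec_mulVec, (hg _).1, (hh _).1, mul_assoc]
    · rw [toMat_mul, ← mulVec_mulVec, (hg _).2 (by rw [(hh v).1, hv, mul_zero]), (hh _).2 hv,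
        mul_assoc]
  inv_mem' := by
    rintro g ⟨a, b, ha, hb, hg⟩
    have h1 : ∀ v, coordT m (toMat g⁻¹ *ᵥ v) = a⁻¹ * coordT m v := by
      intro v
      have h := (hg (toMat g⁻¹ *ᵥ v)).1
      rw [mulVec_mulVec, toMat_mul_inv, one_mulVec] at h
      rw [h, inv_mul_cancel_left₀ ha.ne']
    refine ⟨a⁻¹, b⁻¹, inv_pos.2 ha, inv_pos.2 hb, fun v => ⟨h1 v, fun hv => ?_⟩⟩
    have h := (hg (toMat g⁻¹ *ᵥ v)).2 (by rw [h1, hv, mul_zero])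
    rw [mulVec_mulVec, toMat_mul_inv, one_mulVec] at h
    rw [h, inv_mul_cancel_left₀ hb.ne']

theorem expG_mem_flagSubgroup {X : so m} {a b : ℝ}
    (hX : ∀ v, coordT m ((X : Matrix (Idx m) (Idx m) ℝ) *ᵥ v) = a * coordT m v ∧
      (coordT m v = 0 → coordU m ((X : Matrix (Idx m) (Idx m) ℝ) *ᵥ v) = b * coordU m v)) :
    expG X ∈ flagSubgroup m := by
  have h1 : ∀ v, ∀ n : ℕ, coordT m ((X : Matrix (Idx m) (Idx m) ℝ) ^ n *ᵥ v) =
      a ^ n * coordT m v := by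
    intro v n
    induction n with
    | zero => simp
    | succ n ih => rw [pow_succ', ← mulVec_mulVec, (hX _).1, ih, pow_succ', mul_assoc]
  have h2 : ∀ v, coordT m v = 0 → ∀ n : ℕ, coordU m ((X : Matrix (Idx m) (Idx m) ℝ) ^ n *ᵥ v) =
      b ^ n * coordU m v := by
    intro v hv n
    induction n with
    | zero => simp
    | succ n ih => rw [pow_succ', ← mulVec_mulVec, (hX _).2 (by rw [h1, hv, mul_zero]), ih,
        pow_succ', mul_assoc]
  exact ⟨Real.exp a, Real.exp b, Real.exp_pos _, Real.exp_pos _, fun v =>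
    ⟨linear_exp_mulVec_of_eigen (h1 v), fun hv => linear_exp_mulVec_of_eigen (h2 v hv)⟩⟩

theorem AN_le_flagSubgroup : AN m ≤ flagSubgroup m := by
  refine sup_le ?_ ?_
  · refine (Subgroup.closure_le _).2 ?_
    rintro _ ⟨X, hX, rfl⟩
    obtain ⟨s, r, rfl⟩ := Submodule.mem_span_pair.1 hX
    refine expG_mem_flagSubgroup (a := -s) (b := -r) fun v => ?_
    change coordT m ((s • (J1 m : Matrix (Idx m) (Idx m) ℝ) +
        r • (J2 m : Matrix (Idx m) (Idx m) ℝ)) *ᵥ v) = _ ∧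
      (_ → coordU m ((s • (J1 m : Matrix (Idx m) (Idx m) ℝ) +
        r • (J2 m : Matrix (Idx m) (Idx m) ℝ)) *ᵥ v) = _)
    rw [add_mulVec, Matrix.smul_mulVec, Matrix.smul_mulVec, map_add, map_add, map_smul, map_smul,
      map_smul, map_smul, coordT_J1, coordT_J2, coordU_J1, coordU_J2]
    simp
  · refine (Subgroup.closure_le _).2 ?_
    rintro _ ⟨X, hX, rfl⟩
    refine expG_mem_flagSubgroup (a := 0) (b := 0) fun v => ?_
    simpa using algN_le_flagNil hX v

/-! ### Root vectors -/

theorem ip_comm (v w : Idx m → ℝ) : ip v w = ip w v := by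
  rw [ip_eq, ip_eq]
  simp only [mul_comm]

theorem ip_add_right (v w w' : Idx m → ℝ) : ip v (w + w') = ip v w + ip v w' :=
  dotProduct_add _ _ _

theorem ip_sub_right (v w w' : Idx m → ℝ) : ip v (w - w') = ip v w - ip v w' :=
  dotProduct_sub _ _ _

theorem ip_smul_right (c : ℝ) (v w : Idx m → ℝ) : ip v (c • w) = c * ip v w :=
  dotProduct_smul _ _ _

theorem ip_smul_left (c : ℝ) (v w : Idx m → ℝ) : ip (c • v) w = c * ip v w := by
  rw [ip_comm, ip_smul_right, ip_comm]

theorem ip_so_right (X : so m) (v w : Idx m → ℝ) :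
    ip v ((X : Matrix (Idx m) (Idx m) ℝ) *ᵥ w) = -ip ((X : Matrix (Idx m) (Idx m) ℝ) *ᵥ v) w := by
  unfold ip
  rw [dotProduct_mulVec, ← mulVec_transpose, mulVec_mulVec, mulVec_mulVec, (mem_so_iff _).1 X.2,
    neg_mulVec, neg_dotProduct]

/-- The infinitesimal rotation `v ↦ ⟨q, v⟩ p - ⟨p, v⟩ q`. -/
def wedge (p q : Idx m → ℝ) : so m :=
  ⟨vecMulVec p (eta m *ᵥ q) - vecMulVec q (eta m *ᵥ p), by
    have h : ∀ v : Idx m → ℝ, v ᵥ* eta m = eta m *ᵥ v := fun v => by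
      rw [← mulVec_transpose, eta_transpose]
    rw [mem_so_iff, transpose_sub, transpose_vecMulVec, transpose_vecMulVec, Matrix.sub_mul,
      Matrix.mul_sub, vecMulVec_mul, vecMulVec_mul, mul_vecMulVec, mul_vecMulVec, h, h, neg_sub]⟩

theorem wedge_mulVec (p q v : Idx m → ℝ) : (wedge p q : Matrix (Idx m) (Idx m) ℝ) *ᵥ v =
    ip q v • p - ip p v • q := by
  change (vecMulVec p (eta m *ᵥ q) - vecMulVec q (eta m *ᵥ p)) *ᵥ v = _
  rw [sub_mulVec, vecMulVec_mulVec, vecMulVec_mulVec]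
  simp [ip]

/-- Weights add, so wedges of weight vectors are explicit root vectors. -/
theorem lie_wedge {Z : so m} {p q : Idx m → ℝ} {a b : ℝ}
    (hp : (Z : Matrix (Idx m) (Idx m) ℝ) *ᵥ p = a • p)
    (hq : (Z : Matrix (Idx m) (Idx m) ℝ) *ᵥ q = b • q) :
    ⁅Z, wedge p q⁆ = (a + b) • wedge p q := by
  apply Subtype.ext
  apply Matrix.mulVec_injective
  funext v
  change ((Z : Matrix (Idx m) (Idx m) ℝ) * (wedge p q : Matrix (Idx m) (Idx m) ℝ) -
    (wedge p q : Matrix (Idx m) (Idx m) ℝ) * (Z : Matrix (Idx m) (Idx m) ℝ)) *ᵥ v =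
    ((a + b) • (wedge p q : Matrix (Idx m) (Idx m) ℝ)) *ᵥ v
  rw [sub_mulVec, ← mulVec_mulVec, ← mulVec_mulVec, Matrix.smul_mulVec, wedge_mulVec, wedge_mulVec,
    ip_so_right, ip_so_right, hp, hq, ip_smul_left, ip_smul_left, mulVec_sub, mulVec_smul,
    mulVec_smul, hp, hq]
  module

/-- When p and q span an isotropic subspace the wedge squares to zero, and the exponential is affine
in s. -/
theorem expG_smul_wedge_mulVec {p q : Idx m → ℝ} (hpp : ip p p = 0) (hqq : ip q q = 0)
    (hpq : ip p q = 0) (s : ℝ) (v : Idx m → ℝ) :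
    toMat (expG (s • wedge p q)) *ᵥ v = v + s • (ip q v • p - ip p v • q) := by
  have h : ∀ v, ((s • wedge p q : so m) : Matrix (Idx m) (Idx m) ℝ) *ᵥ v =
      s • (ip q v • p - ip p v • q) := by
    intro v
    change (s • (wedge p q : Matrix (Idx m) (Idx m) ℝ)) *ᵥ v = _
    rw [Matrix.smul_mulVec, wedge_mulVec]
  have hqp : ip q p = 0 := by rw [ip_comm, hpq]
  rw [toMat_expG, exp_mulVec_of_sq_eq_zero, h]
  rw [h, h]
  simp [ip_sub_right, ip_smul_right, hpp, hqq, hpq, hqp]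

/-- With q possibly non-isotropic only the cube vanishes, which accounts for the term in ⟨q, q⟩. -/
theorem expG_wedge_mulVec {p q : Idx m → ℝ} (hpp : ip p p = 0) (hpq : ip p q = 0)
    (v : Idx m → ℝ) : toMat (expG (wedge p q)) *ᵥ v =
      v - ip p v • q + (ip q v - 1 / 2 * (ip p v * ip q q)) • p := by
  have hqp : ip q p = 0 := by rw [ip_comm, hpq]
  have h2 : (wedge p q : Matrix (Idx m) (Idx m) ℝ) *ᵥ
      ((wedge p q : Matrix (Idx m) (Idx m) ℝ) *ᵥ v) = -(ip p v * ip q q) • p := by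
    rw [wedge_mulVec p q v, wedge_mulVec]
    simp [ip_sub_right, ip_smul_right, hpp, hpq, hqp]
  rw [toMat_expG, exp_mulVec_of_cube_eq_zero, h2, wedge_mulVec]
  · module
  · rw [h2, mulVec_smul, wedge_mulVec, hpp, hqp]
    simp

/-- The vectors `e_t + s e_{x₁}`, isotropic for `s = ±1`. -/
def nullT (m : ℕ) (s : ℝ) : Idx m → ℝ := Pi.single (Sum.inl 1) 1 + Pi.single (Sum.inr 0) s

/-- The vectors `e_u + s e_{x₂}`, isotropic for `s = ±1`. -/
def nullU (m : ℕ) (s : ℝ) : Idx m → ℝ := Pi.single (Sum.inl 0) 1 + Pi.single (Sum.inr 1) s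

theorem ip_nullT (s : ℝ) (v : Idx m → ℝ) :
    ip (nullT m s) v = v (Sum.inl 1) - s * v (Sum.inr 0) := by
  rw [ip_eq]
  simp [nullT, Pi.single_apply]

theorem ip_nullU (s : ℝ) (v : Idx m → ℝ) :
    ip (nullU m s) v = v (Sum.inl 0) - s * v (Sum.inr 1) := by
  rw [ip_eq]
  simp [nullU, Pi.single_apply]

theorem ip_nullT_nullU (s r : ℝ) : ip (nullT m s) (nullU m r) = 0 := by
  rw [ip_nullT]
  simp [nullU]

theorem ip_nullT_self {s : ℝ} (hs : s * s = 1) : ip (nullT m s) (nullT m s) = 0 := by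
  rw [ip_nullT]
  simp [nullT, hs]

theorem ip_nullU_self {s : ℝ} (hs : s * s = 1) : ip (nullU m s) (nullU m s) = 0 := by
  rw [ip_nullU]
  simp [nullU, hs]

theorem J1_nullT {s : ℝ} (hs : s * s = 1) :
    (J1 m : Matrix (Idx m) (Idx m) ℝ) *ᵥ nullT m s = s • nullT m s := by
  rw [J1_mulVec]
  simp [nullT, ← Pi.single_smul, hs]

theorem J2_nullU {s : ℝ} (hs : s * s = 1) :
    (J2 m : Matrix (Idx m) (Idx m) ℝ) *ᵥ nullU m s = s • nullU m s := by
  rw [J2_mulVec]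
  simp [nullU, ← Pi.single_smul, hs]

theorem J1_nullU (s : ℝ) : (J1 m : Matrix (Idx m) (Idx m) ℝ) *ᵥ nullU m s = (0 : ℝ) • nullU m s := by
  rw [J1_mulVec]
  simp [nullU]

theorem J2_nullT (s : ℝ) : (J2 m : Matrix (Idx m) (Idx m) ℝ) *ᵥ nullT m s = (0 : ℝ) • nullT m s := by
  rw [J2_mulVec]
  simp [nullT]

theorem wedge_nullT_nullU_mem_algN {s : ℝ} (hs : s = 1 ∨ s = -1) :
    wedge (nullT m 1) (nullU m s) ∈ algN m := by
  have hs2 : s * s = 1 := by rcases hs with rfl | rfl <;> norm_num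
  have h : wedge (nullT m 1) (nullU m s) ∈ rootSpace m 1 s := by
    have h1 := lie_wedge (J1_nullT (m := m) (mul_one 1)) (J1_nullU s)
    have h2 := lie_wedge (J2_nullT (m := m) 1) (J2_nullU hs2)
    rw [add_zero] at h1
    rw [zero_add] at h2
    exact ⟨h1, h2⟩
  rcases hs with rfl | rfl
  · exact Submodule.mem_sup_left (Submodule.mem_sup_right h)
  · exact Submodule.mem_sup_right h

/-- The vectors with vanishing coordinates `u, t, x₁, x₂`. -/
def IsTransverse (y : Idx m → ℝ) : Prop :=
  y (Sum.inl 0) = 0 ∧ y (Sum.inl 1) = 0 ∧ y (Sum.inr 0) = 0 ∧ y (Sum.inr 1) = 0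

theorem wedge_nullU_mem_algN {y : Idx m → ℝ} (hy : IsTransverse y) :
    wedge (nullU m 1) y ∈ algN m := by
  obtain ⟨h0, h1, h2, h3⟩ := hy
  have e1 : (J1 m : Matrix (Idx m) (Idx m) ℝ) *ᵥ y = (0 : ℝ) • y := by
    simp [J1_mulVec, h1, h2]
  have e2 : (J2 m : Matrix (Idx m) (Idx m) ℝ) *ᵥ y = (0 : ℝ) • y := by
    simp [J2_mulVec, h0, h3]
  have h : wedge (nullU m 1) y ∈ rootSpace m 0 1 := by
    have h1 := lie_wedge (J1_nullU (m := m) 1) e1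
    have h2 := lie_wedge (J2_nullU (m := m) (mul_one 1)) e2
    rw [add_zero] at h1 h2
    exact ⟨h1, h2⟩
  exact Submodule.mem_sup_left (Submodule.mem_sup_left (Submodule.mem_sup_right h))

theorem expG_mem_AN_of_mem_algN {X : so m} (hX : X ∈ algN m) : expG X ∈ AN m :=
  (le_sup_right : expSubgroup (algN m) ≤ AN m) (Subgroup.subset_closure ⟨X, hX, rfl⟩)

theorem expG_mem_AN_of_mem_algA {X : so m} (hX : X ∈ algA m) : expG X ∈ AN m :=
  (le_sup_left : expSubgroup (algA m) ≤ AN m) (Subgroup.subset_closure ⟨X, hX, rfl⟩)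

/-! ### The closed orbits of `AN` -/

theorem idx_cases {P : Idx m → Prop} (h0 : P (Sum.inl 0)) (h1 : P (Sum.inl 1))
    (h2 : P (Sum.inr 0)) (h3 : P (Sum.inr 1)) (h : ∀ j, j ≠ 0 → j ≠ 1 → P (Sum.inr j)) :
    ∀ i, P i := by
  rintro (i | j)
  · fin_cases i
    · exact h0
    · exact h1
  · by_cases hj0 : j = 0
    · rw [hj0]
      exact h2
    · by_cases hj1 : j = 1
      · rw [hj1]
        exact h3
      · exact h j hj0 hj1

theorem AN_smul {h : G m} (hh : h ∈ AN m) (p : AdS m) : h • p ∈ MulAction.orbit (AN m) p :=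
  ⟨⟨h, hh⟩, rfl⟩

theorem coordT_emb_of_mem_orbit {p q : AdS m} (h : q ∈ MulAction.orbit (AN m) p) :
    coordT m (emb q) = 0 ↔ coordT m (emb p) = 0 := by
  obtain ⟨k, rfl⟩ := h
  obtain ⟨a, b, ha, hb, hk⟩ := AN_le_flagSubgroup k.2
  change coordT m (emb (k.1 • p)) = 0 ↔ _
  rw [emb_smul, (hk _).1, mul_eq_zero, or_iff_right ha.ne']

theorem coordU_emb_of_mem_orbit {p q : AdS m} (h : q ∈ MulAction.orbit (AN m) p)
    (hp : coordT m (emb p) = 0) (s : ℝ) :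
    0 ≤ s * coordU m (emb q) ↔ 0 ≤ s * coordU m (emb p) := by
  obtain ⟨k, rfl⟩ := h
  obtain ⟨a, b, ha, hb, hk⟩ := AN_le_flagSubgroup k.2
  change 0 ≤ s * coordU m (emb (k.1 • p)) ↔ _
  rw [emb_smul, (hk _).2 hp, mul_left_comm, mul_nonneg_iff_of_pos_left hb]

/-- If t = x₁ and u = x₂, then ⟨v, v⟩ is minus a sum of squares, not 1. -/
theorem coordU_emb_ne_zero {p : AdS m} (hp : coordT m (emb p) = 0) : coordU m (emb p) ≠ 0 := by
  intro h
  have h1 := ip_emb p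
  rw [coordT_apply, sub_eq_zero] at hp
  rw [coordU_apply, sub_eq_zero] at h
  rw [ip_eq, Fin.sum_univ_succ, Fin.sum_univ_succ, Fin.succ_zero_eq_one, hp, h] at h1
  have h2 : 0 ≤ ∑ j : Fin m, emb p (Sum.inr j.succ.succ) * emb p (Sum.inr j.succ.succ) :=
    Finset.sum_nonneg fun j _ => mul_self_nonneg _
  linarith

/-- A point with `t = x₁` can be moved by `N` into the plane `t = x₁ = x₃ = ⋯ = 0`. -/
theorem exists_mem_orbit_plane {p : AdS m} (hp : coordT m (emb p) = 0) :
    ∃ q ∈ MulAction.orbit (AN m) p, ∃ a b : ℝ, emb q = a • nullU m (-1) + b • nullU m 1 := by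
  have hc := coordU_emb_ne_zero hp
  set c := coordU m (emb p) with hcdef
  set v := emb p with hv
  -- Scaled by c⁻¹ so that v - c y loses all coordinates x₃, x₄, ….
  let y : Idx m → ℝ := fun i => if i = Sum.inl 0 ∨ i = Sum.inl 1 ∨ i = Sum.inr 0 ∨ i = Sum.inr 1
    then 0 else c⁻¹ * v i
  have hy : IsTransverse y := ⟨by simp [y], by simp [y], by simp [y], by simp [y]⟩
  have hU : ip (nullU m 1) v = c := by rw [ip_nullU, hcdef, coordU_apply, one_mul]
  have hUy : ip (nullU m 1) y = 0 := by rw [ip_nullU, hy.1, hy.2.2.2]; ring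
  have h1 := expG_wedge_mulVec (ip_nullU_self (m := m) (mul_one 1)) hUy v
  rw [hU] at h1
  set κ := ip y v - 1 / 2 * (c * ip y y) with hκ
  have hvt : v (Sum.inl 1) = v (Sum.inr 0) := by rwa [coordT_apply, sub_eq_zero] at hp
  -- Chosen with s c = -x₁, which cancels the common value of t and x₁.
  let s : ℝ := -(c⁻¹ * v (Sum.inr 0))
  set w := v - c • y + κ • nullU m 1 with hw
  have hwU : ip (nullU m 1) w = c := by
    rw [hw, ip_add_right, ip_sub_right, ip_smul_right, ip_smul_right, hU, hUy,
      ip_nullU_self (mul_one 1)]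
    ring
  have hwT : ip (nullT m 1) w = 0 := by
    have : ip (nullT m 1) y = 0 := by rw [ip_nullT, hy.2.1, hy.2.2.1]; ring
    rw [hw, ip_add_right, ip_sub_right, ip_smul_right, ip_smul_right, this, ip_nullT_nullU,
      ip_nullT, hvt]
    ring
  have h2 := expG_smul_wedge_mulVec (ip_nullT_self (m := m) (mul_one 1))
    (ip_nullU_self (mul_one 1)) (ip_nullT_nullU 1 1) s w
  rw [hwU, hwT, zero_smul, sub_zero] at h2
  refine ⟨(expG (s • wedge (nullT m 1) (nullU m 1)) * expG (wedge (nullU m 1) y)) • p,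
    AN_smul (mul_mem (expG_mem_AN_of_mem_algN (Submodule.smul_mem _ _
      (wedge_nullT_nullU_mem_algN (Or.inl rfl)))) (expG_mem_AN_of_mem_algN
        (wedge_nullU_mem_algN hy))) p, c / 2, (v (Sum.inl 0) + v (Sum.inr 1)) / 2 + κ, ?_⟩
  rw [emb_smul, toMat_mul, ← mulVec_mulVec, ← hv, h1, h2, hw]
  funext i
  revert i
  have hsc : s * c = - v (Sum.inr 0) := by
    simp only [s]
    field_simp
  have hc2 : c = v (Sum.inl 0) - v (Sum.inr 1) := hcdef
  refine idx_cases ?_ ?_ ?_ ?_ ?_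
  · simp [nullU, nullT, hy.1, hc2]
    ring
  · simp [nullU, nullT, hy.2.1, hsc, hvt]
  · simp [nullU, nullT, hy.2.2.1, hsc]
  · simp [nullU, nullT, hy.2.2.2, hc2]
    ring
  · intro j h0 h1
    simp [nullU, nullT, h0, h1, y, mul_inv_cancel_left₀ hc]

theorem expG_smul_J2_mulVec (r a b : ℝ) :
    toMat (expG (r • J2 m)) *ᵥ (a • nullU m (-1) + b • nullU m 1) =
      (Real.exp (-r) * a) • nullU m (-1) + (Real.exp r * b) • nullU m 1 := by
  have h : ∀ s : ℝ, s * s = 1 → toMat (expG (r • J2 m)) *ᵥ nullU m s =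
      Real.exp (r * s) • nullU m s := by
    intro s hs
    rw [toMat_expG]
    apply exp_mulVec_of_eigen
    change (r • (J2 m : Matrix (Idx m) (Idx m) ℝ)) *ᵥ nullU m s = _
    rw [Matrix.smul_mulVec, J2_nullU hs, smul_smul]
  rw [mulVec_add, mulVec_smul, mulVec_smul, h _ (by norm_num), h _ (by norm_num), smul_smul,
    smul_smul, mul_neg_one, mul_one, mul_comm a, mul_comm b]

/-- A point with `t = x₁` and `± (u - x₂) ≥ 0` can be moved by `AN` to `± e_u`. -/
theorem exists_mem_orbit_base {p : AdS m} (hp : coordT m (emb p) = 0) {s : ℝ} (hs : s * s = 1)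
    (hps : 0 ≤ s * coordU m (emb p)) :
    ∃ q ∈ MulAction.orbit (AN m) p, emb q = s • baseVec m := by
  obtain ⟨q, hq, a, b, hab⟩ := exists_mem_orbit_plane hp
  have hq0 := (coordT_emb_of_mem_orbit hq).2 hp
  have hqs := (coordU_emb_of_mem_orbit hq hp s).2 hps
  have hne := coordU_emb_ne_zero hq0
  have hU : coordU m (emb q) = 2 * a := by
    rw [hab, coordU_apply]
    simp [nullU]
    ring
  rw [hU] at hqs hne
  have ha : a ≠ 0 := fun h => hne (by rw [h, mul_zero])
  have hs0 : s ≠ 0 := fun h => by simp [h] at hs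
  have hpos : 0 < s * (2 * a) := lt_of_le_of_ne hqs (mul_ne_zero hs0 hne).symm
  -- The equation of the quadric in the null basis, whose mutual product is 2.
  have h1 : 4 * (a * b) = 1 := by
    have h := ip_emb q
    have e1 : ip (nullU m (-1)) (nullU m 1) = 2 := by
      rw [ip_nullU]
      simp [nullU]
      norm_num
    have e2 : ip (nullU m 1) (nullU m (-1)) = 2 := by rw [ip_comm, e1]
    nth_rewrite 2 [hab] at h
    rw [ip_add_right, ip_smul_right, ip_smul_right, ip_comm, ip_comm (emb q), hab, ip_add_right,
      ip_add_right, ip_smul_right, ip_smul_right, ip_smul_right, ip_smul_right, e1, e2,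
      ip_nullU_self (by norm_num), ip_nullU_self (by norm_num)] at h
    linarith
  -- This time makes both null coordinates equal to s/2, and the two null vectors add up to 2 e_u.
  refine ⟨expG (Real.log (s * (2 * a)) • J2 m) • q, ?_, ?_⟩
  · rw [← MulAction.orbit_eq_iff.2 hq]
    exact AN_smul (expG_mem_AN_of_mem_algA (Submodule.smul_mem _ _
      (Submodule.subset_span (by simp)))) q
  · rw [emb_smul, hab, expG_smul_J2_mulVec, Real.exp_neg, Real.exp_log hpos]
    have e1 : (s * (2 * a))⁻¹ * a = s / 2 := by
      field_simp
      linarith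
    have e2 : s * (2 * a) * b = s / 2 := by
      linear_combination s / 2 * h1
    rw [e1, e2, ← smul_add, baseVec]
    have e3 : nullU m (-1) + nullU m 1 = Pi.single (Sum.inl 0) (2 : ℝ) := by
      rw [nullU, nullU, add_add_add_comm, ← Pi.single_add, ← Pi.single_add]
      norm_num
    rw [e3, ← Pi.single_smul, ← Pi.single_smul]
    congr 1
    simp

theorem isClosed_orbit_AN {p : AdS m} (hp : coordT m (emb p) = 0) :
    IsClosed (MulAction.orbit (AN m) p) := by
  obtain ⟨s, hs, hps⟩ : ∃ s : ℝ, s * s = 1 ∧ 0 ≤ s * coordU m (emb p) := by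
    rcases le_total 0 (coordU m (emb p)) with h | h
    · exact ⟨1, by norm_num, by linarith⟩
    · exact ⟨-1, by norm_num, by linarith⟩
  -- The weak inequality suffices because u - x₂ never vanishes on t = x₁; this is what makes the
  -- orbit closed.
  have h : MulAction.orbit (AN m) p =
      {q | coordT m (emb q) = 0 ∧ 0 ≤ s * coordU m (emb q)} := by
    ext q
    constructor
    · intro hq
      exact ⟨(coordT_emb_of_mem_orbit hq).2 hp, (coordU_emb_of_mem_orbit hq hp s).2 hps⟩
    · rintro ⟨hq, hqs⟩
      obtain ⟨p', hp', e1⟩ := exists_mem_orbit_base hp hs hps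
      obtain ⟨q', hq', e2⟩ := exists_mem_orbit_base hq hs hqs
      have e : p' = q' := emb_injective (e1.trans e2.symm)
      subst e
      rw [← MulAction.orbit_eq_iff.2 hp', MulAction.orbit_eq_iff.2 hq']
      exact MulAction.mem_orbit_self q
  rw [h]
  have hT : Continuous fun q : AdS m => coordT m (emb q) :=
    (LinearMap.continuous_of_finiteDimensional _).comp continuous_emb
  have hU : Continuous fun q : AdS m => coordU m (emb q) :=
    (LinearMap.continuous_of_finiteDimensional _).comp continuous_emb
  exact (isClosed_eq hT continuous_const).inter
    (isClosed_le continuous_const (continuous_const.mul hU))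

/-- A point with `t ≠ x₁` can be moved by `N` to a point with `u - x₂ = 1` and `t + x₁ = 0`. -/
theorem exists_mem_orbit_normal {p : AdS m} (hp : coordT m (emb p) ≠ 0) :
    ∃ q ∈ MulAction.orbit (AN m) p, ip (nullU m 1) (emb q) = 1 ∧ ip (nullT m (-1)) (emb q) = 0 := by
  set v := emb p with hv
  set b := coordT m v with hb
  have hTv : ip (nullT m 1) v = b := by rw [ip_nullT, one_mul, hb, coordT_apply]
  have hT : ip (nullT m 1) (nullT m 1) = 0 := ip_nullT_self (mul_one 1)
  have hU : ip (nullU m 1) (nullU m 1) = 0 := ip_nullU_self (mul_one 1)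
  have hU' : ip (nullU m (-1)) (nullU m (-1)) = 0 := ip_nullU_self (by norm_num)
  have hUU : ip (nullU m 1) (nullU m (-1)) = 2 := by
    rw [ip_nullU]
    simp [nullU]
    norm_num
  have hUU' : ip (nullU m (-1)) (nullU m 1) = 2 := by rw [ip_comm, hUU]
  have hTU : ∀ r : ℝ, ip (nullU m r) (nullT m 1) = 0 := fun r => by rw [ip_comm, ip_nullT_nullU]
  -- Solves u - x₂ = 1 after the move by the root (1, -1); this is possible because b ≠ 0.
  let s₁ : ℝ := (ip (nullU m 1) v - 1) / (2 * b)
  set w := v + s₁ • (ip (nullU m (-1)) v • nullT m 1 - b • nullU m (-1)) with hw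
  have hTw : ip (nullT m 1) w = b := by
    rw [hw, ip_add_right, ip_smul_right, ip_sub_right, ip_smul_right, ip_smul_right,
      ip_nullT_nullU, hT, hTv]
    ring
  have hUw : ip (nullU m 1) w = 1 := by
    rw [hw, ip_add_right, ip_smul_right, ip_sub_right, ip_smul_right, ip_smul_right, hTU, hUU]
    simp only [s₁]
    field_simp
    ring
  -- The root (1, 1) keeps u - x₂ = 1 and adjusts u + x₂ to 1 + x₃² + x₄² + ⋯. The quadric then
  -- forces (t - x₁)(t + x₁) = 0, hence t + x₁ = 0.
  let s₂ : ℝ := (ip (nullU m (-1)) w -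
    (1 + ∑ j : Fin m, w (Sum.inr j.succ.succ) * w (Sum.inr j.succ.succ))) / (2 * b)
  set z := w + s₂ • ((1 : ℝ) • nullT m 1 - b • nullU m 1) with hz
  have hTz : ip (nullT m 1) z = b := by
    rw [hz, ip_add_right, ip_smul_right, ip_sub_right, ip_smul_right, ip_smul_right,
      ip_nullT_nullU, hT, hTw]
    ring
  have hUz : ip (nullU m 1) z = 1 := by
    rw [hz, ip_add_right, ip_smul_right, ip_sub_right, ip_smul_right, ip_smul_right, hTU, hU, hUw]
    ring
  have hzj : ∀ j : Fin m, z (Sum.inr j.succ.succ) = w (Sum.inr j.succ.succ) := by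
    intro j
    have h1 : j.succ.succ ≠ 1 := by
      rw [← Fin.succ_zero_eq_one]
      exact fun h => Fin.succ_ne_zero j (Fin.succ_injective _ h)
    simp [hz, nullT, nullU, h1]
  have hUz' : ip (nullU m (-1)) z =
      1 + ∑ j : Fin m, z (Sum.inr j.succ.succ) * z (Sum.inr j.succ.succ) := by
    simp only [hzj]
    rw [hz, ip_add_right, ip_smul_right, ip_sub_right, ip_smul_right, ip_smul_right, hTU, hUU']
    simp only [s₂]
    field_simp
    ring
  have h1 := expG_smul_wedge_mulVec hT hU' (ip_nullT_nullU 1 (-1)) s₁ v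
  rw [hTv, ← hw] at h1
  have h2 := expG_smul_wedge_mulVec hT hU (ip_nullT_nullU 1 1) s₂ w
  rw [hTw, hUw, ← hz] at h2
  have he : emb ((expG (s₂ • wedge (nullT m 1) (nullU m 1)) *
      expG (s₁ • wedge (nullT m 1) (nullU m (-1)))) • p) = z := by
    rw [emb_smul, toMat_mul, ← mulVec_mulVec, ← hv, h1, h2]
  refine ⟨_, AN_smul (mul_mem (expG_mem_AN_of_mem_algN (Submodule.smul_mem _ s₂
      (wedge_nullT_nullU_mem_algN (Or.inl rfl)))) (expG_mem_AN_of_mem_algN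
        (Submodule.smul_mem _ s₁ (wedge_nullT_nullU_mem_algN (Or.inr rfl))))) p, ?_⟩
  have hn := ip_emb ((expG (s₂ • wedge (nullT m 1) (nullU m 1)) *
      expG (s₁ • wedge (nullT m 1) (nullU m (-1)))) • p)
  rw [he] at hn ⊢
  refine ⟨hUz, ?_⟩
  rw [ip_eq, Fin.sum_univ_succ, Fin.sum_univ_succ, Fin.succ_zero_eq_one] at hn
  rw [ip_nullT] at hTz ⊢
  rw [ip_nullU] at hUz hUz'
  apply (mul_eq_zero_iff_left hp).1
  rw [← hTz]
  generalize (∑ j : Fin m, z (Sum.inr j.succ.succ) * z (Sum.inr j.succ.succ)) = S at *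
  linear_combination hn - hUz' - (z (Sum.inl 0) + z (Sum.inr 1)) * hUz

/-- If t + x₁ = 0, the vector is a multiple of the (-1)-eigenvector e_t - e_{x₁} plus an element of
the kernel of J₁. -/
theorem expG_smul_J1_mulVec {v : Idx m → ℝ} (hv : ip (nullT m (-1)) v = 0) (r : ℝ) :
    toMat (expG (r • J1 m)) *ᵥ v = v + ((Real.exp (-r) - 1) * v (Sum.inl 1)) • nullT m (-1) := by
  have hx : v (Sum.inr 0) = -v (Sum.inl 1) := by
    rw [ip_nullT] at hv
    linarith
  set a := v (Sum.inl 1) with ha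
  have h0 : (J1 m : Matrix (Idx m) (Idx m) ℝ) *ᵥ (v - a • nullT m (-1)) = 0 := by
    rw [J1_mulVec]
    simp [nullT, hx, ha]
  have h1 : toMat (expG (r • J1 m)) *ᵥ (v - a • nullT m (-1)) = v - a • nullT m (-1) := by
    have h2 : ((r • J1 m : so m) : Matrix (Idx m) (Idx m) ℝ) *ᵥ (v - a • nullT m (-1)) = 0 := by
      change (r • (J1 m : Matrix (Idx m) (Idx m) ℝ)) *ᵥ _ = 0
      rw [Matrix.smul_mulVec, h0, smul_zero]
    rw [toMat_expG, exp_mulVec_of_sq_eq_zero (by rw [h2, mulVec_zero]), h2, add_zero]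
  have h3 : toMat (expG (r • J1 m)) *ᵥ nullT m (-1) = Real.exp (-r) • nullT m (-1) := by
    rw [toMat_expG]
    apply exp_mulVec_of_eigen
    change (r • (J1 m : Matrix (Idx m) (Idx m) ℝ)) *ᵥ _ = _
    rw [Matrix.smul_mulVec, J1_nullT (by norm_num), smul_smul, mul_neg_one]
  calc _ = toMat (expG (r • J1 m)) *ᵥ (v - a • nullT m (-1)) +
        a • (toMat (expG (r • J1 m)) *ᵥ nullT m (-1)) := by
          rw [← mulVec_smul, ← mulVec_add, sub_add_cancel]
    _ = _ := by
      rw [h1, h3]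
      module

theorem continuous_expG_smul (X : so m) : Continuous fun r : ℝ => expG (r • X) :=
  Continuous.subtype_mk (Continuous.subtype_mk
    (continuous_exp_smul (X : Matrix (Idx m) (Idx m) ℝ)) _) _

theorem continuous_expG_smul_smul (X : so m) (p : AdS m) :
    Continuous fun r : ℝ => expG (r • X) • p := by
  obtain ⟨g, rfl⟩ := proj_surjective p
  exact continuous_quot_mk.comp ((continuous_expG_smul X).mul continuous_const)

theorem coordT_emb_eq_zero_of_isClosed {p : AdS m} (h : IsClosed (MulAction.orbit (AN m) p)) :
    coordT m (emb p) = 0 := by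
  by_contra hp
  obtain ⟨q, hq, hU, hT⟩ := exists_mem_orbit_normal hp
  set v := emb q with hv
  have hZ : ∀ r : ℝ, emb (expG (r • wedge (nullT m (-1)) (nullU m 1)) • q) =
      v + r • nullT m (-1) := by
    intro r
    rw [emb_smul, expG_smul_wedge_mulVec (ip_nullT_self (by norm_num))
      (ip_nullU_self (by norm_num)) (ip_nullT_nullU _ _), ← hv, hU, hT, one_smul, zero_smul,
      sub_zero]
  -- For τ > 0 this is the J₁-flow at time -log τ, inside the orbit. The root vector of root (-1, 1)
  -- extends the ray to τ = 0, where t = x₁.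
  let γ : ℝ → AdS m := fun τ =>
    expG (((τ - 1) * v (Sum.inl 1)) • wedge (nullT m (-1)) (nullU m 1)) • q
  have hγ : Continuous γ :=
    (continuous_expG_smul_smul (wedge (nullT m (-1)) (nullU m 1)) q).comp (by fun_prop)
  have hmem : Set.Ioi 0 ⊆ γ ⁻¹' MulAction.orbit (AN m) p := by
    intro τ hτ
    have hτ' : γ τ = expG ((-Real.log τ) • J1 m) • q := by
      apply emb_injective
      rw [hZ, emb_smul, ← hv, expG_smul_J1_mulVec hT, neg_neg, Real.exp_log hτ]
    rw [Set.mem_preimage, hτ', ← MulAction.orbit_eq_iff.2 hq]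
    exact AN_smul (expG_mem_AN_of_mem_algA (Submodule.smul_mem _ _
      (Submodule.subset_span (by simp)))) q
  have hcl := closure_minimal hmem (h.preimage hγ)
  rw [closure_Ioi] at hcl
  have h0 : γ 0 ∈ MulAction.orbit (AN m) p := hcl Set.self_mem_Ici
  apply hp
  rw [← coordT_emb_of_mem_orbit h0, hZ, coordT_apply]
  rw [ip_nullT] at hT
  simp [nullT]
  linarith

theorem isClosed_orbit_AN_iff (p : AdS m) :
    IsClosed (MulAction.orbit (AN m) p) ↔ coordT m (emb p) = 0 :=
  ⟨coordT_emb_eq_zero_of_isClosed, isClosed_orbit_AN⟩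

/-! ### The closed orbits of `A N̄` -/

/-- The signs of the reflection of `x₁` and `x₂`. -/
def flipSign (m : ℕ) (i : Idx m) : ℝ := if i = Sum.inr 0 ∨ i = Sum.inr 1 then -1 else 1

theorem flipSign_mul_self (i : Idx m) : flipSign m i * flipSign m i = 1 := by
  unfold flipSign
  split_ifs <;> norm_num

theorem det_flip : (Matrix.diagonal (flipSign m)).det = 1 := by
  rw [det_diagonal, Fintype.prod_sum_type, Fin.prod_univ_succ (n := m + 1),
    Fin.prod_univ_succ (n := m)]
  have h : ∀ j : Fin m, j.succ.succ ≠ 1 := fun j h => Fin.succ_ne_zero j (Fin.succ_injective _ h)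
  simp [flipSign, h]

/-- The element `diag(1, 1, -1, -1, 1, …, 1)` of `G`, which conjugates `AN` to `A N̄`. -/
def flip (m : ℕ) : G m :=
  ⟨⟨Matrix.diagonal (flipSign m), det_flip⟩, by
    change (Matrix.diagonal (flipSign m))ᵀ * eta m * Matrix.diagonal (flipSign m) = eta m
    unfold eta LieAlgebra.Orthogonal.indefiniteDiagonal
    rw [diagonal_transpose, diagonal_mul_diagonal, diagonal_mul_diagonal]
    congr 1
    funext i
    rw [mul_right_comm, flipSign_mul_self, one_mul]⟩

theorem toMat_flip : toMat (flip m) = Matrix.diagonal (flipSign m) := rfl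

theorem flip_mul_self : flip m * flip m = 1 := by
  apply G_ext
  rw [toMat_mul, toMat_flip, toMat_one, diagonal_mul_diagonal, ← diagonal_one]
  congr 1
  funext i
  exact flipSign_mul_self i

theorem flip_inv : (flip m)⁻¹ = flip m := inv_eq_of_mul_eq_one_left flip_mul_self

theorem emb_flip_smul (p : AdS m) (i : Idx m) : emb (flip m • p) i = flipSign m i * emb p i := by
  rw [emb_smul, toMat_flip, mulVec_diagonal]

/-- The adjoint action of `g` as a linear map. -/
def adLin (g : G m) : so m →ₗ[ℝ] so m where
  toFun := Ad g
  map_add' X Y := by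
    apply Subtype.ext
    change toMat g * ((X : Matrix (Idx m) (Idx m) ℝ) + (Y : Matrix (Idx m) (Idx m) ℝ)) *
      toMat g⁻¹ = toMat g * (X : Matrix (Idx m) (Idx m) ℝ) * toMat g⁻¹ +
        toMat g * (Y : Matrix (Idx m) (Idx m) ℝ) * toMat g⁻¹
    rw [Matrix.mul_add, Matrix.add_mul]
  map_smul' c X := Ad_smul g c X

theorem adLin_apply (g : G m) (X : so m) : adLin g X = Ad g X := rfl

theorem Ad_lie (g : G m) (X Y : so m) : Ad g ⁅X, Y⁆ = ⁅Ad g X, Ad g Y⁆ := by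
  apply Subtype.ext
  have h : ∀ A B : Matrix (Idx m) (Idx m) ℝ, toMat g * A * toMat g⁻¹ * (toMat g * B * toMat g⁻¹) =
      toMat g * (A * B) * toMat g⁻¹ := by
    intro A B
    calc _ = toMat g * A * (toMat g⁻¹ * toMat g) * (B * toMat g⁻¹) := by
          simp only [Matrix.mul_assoc]
      _ = _ := by rw [toMat_inv_mul, Matrix.mul_one]; simp only [Matrix.mul_assoc]
  rw [coe_Ad, coe_lie, coe_lie, coe_Ad, coe_Ad, h, h, Matrix.mul_sub, Matrix.sub_mul]

theorem Ad_mul (g h : G m) (X : so m) : Ad (g * h) X = Ad g (Ad h X) := by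
  apply Subtype.ext
  rw [coe_Ad, coe_Ad, coe_Ad, _root_.mul_inv_rev, toMat_mul, toMat_mul]
  simp only [Matrix.mul_assoc]

theorem Ad_one (X : so m) : Ad 1 X = X := by
  apply Subtype.ext
  rw [coe_Ad, inv_one, toMat_one, Matrix.one_mul, Matrix.mul_one]

/-! ### Two involutions that reverse the roots -/

theorem coe_theta (X : so m) : (theta m X : Matrix (Idx m) (Idx m) ℝ) =
    -(X : Matrix (Idx m) (Idx m) ℝ)ᵀ := rfl

theorem theta_theta (X : so m) : theta m (theta m X) = X := by
  apply Subtype.ext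
  rw [coe_theta, coe_theta, transpose_neg, transpose_transpose, neg_neg]

theorem theta_lie (X Y : so m) : theta m ⁅X, Y⁆ = ⁅theta m X, theta m Y⁆ := by
  apply Subtype.ext
  rw [coe_theta, coe_lie, coe_lie, coe_theta, coe_theta, transpose_sub, transpose_mul,
    transpose_mul]
  noncomm_ring

theorem theta_boost (i : Fin 2) (j : Fin (m + 2)) : theta m (boost i j) = -boost i j := by
  apply Subtype.ext
  rw [coe_theta]
  change -(Matrix.single (Sum.inl i) (Sum.inr j) (1 : ℝ) +
    Matrix.single (Sum.inr j) (Sum.inl i) 1)ᵀ = -(Matrix.single (Sum.inl i) (Sum.inr j) (1 : ℝ) +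
    Matrix.single (Sum.inr j) (Sum.inl i) 1)
  rw [transpose_add, transpose_single, transpose_single, add_comm]

theorem Ad_flip_boost (i : Fin 2) {j : Fin (m + 2)} (hj : j = 0 ∨ j = 1) :
    Ad (flip m) (boost i j) = -boost i j := by
  apply Subtype.ext
  rw [coe_Ad, flip_inv, toMat_flip]
  change diagonal (flipSign m) * (Matrix.single (Sum.inl i) (Sum.inr j) (1 : ℝ) +
    Matrix.single (Sum.inr j) (Sum.inl i) 1) * diagonal (flipSign m) =
    -(Matrix.single (Sum.inl i) (Sum.inr j) (1 : ℝ) + Matrix.single (Sum.inr j) (Sum.inl i) 1)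
  have h1 : flipSign m (Sum.inl i) = 1 := by simp [flipSign]
  have h2 : flipSign m (Sum.inr j) = -1 := by simp [flipSign, hj]
  ext a b
  rw [Matrix.mul_diagonal, Matrix.diagonal_mul, Matrix.neg_apply, Matrix.add_apply,
    Matrix.single_apply, Matrix.single_apply]
  split_ifs with h3 h4 h4
  · simp [← h3.1] at h4
  · rw [← h3.1, ← h3.2, h1, h2]
    norm_num
  · rw [← h4.1, ← h4.2, h1, h2]
    norm_num
  · norm_num

/-- An involutive automorphism that reverses `J₁` and `J₂` reverses the roots. -/
theorem map_rootSpace {f : so m →ₗ[ℝ] so m} (hf : ∀ X, f (f X) = X)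
    (hl : ∀ X Y, f ⁅X, Y⁆ = ⁅f X, f Y⁆) (h1 : f (J1 m) = -J1 m) (h2 : f (J2 m) = -J2 m)
    (α β : ℝ) : (rootSpace m α β).map f = rootSpace m (-α) (-β) := by
  have key : ∀ (α β : ℝ) (X : so m), X ∈ rootSpace m α β → f X ∈ rootSpace m (-α) (-β) := by
    rintro α β X ⟨e1, e2⟩
    constructor
    · have h := hl (J1 m) X
      rw [e1, h1, neg_lie, map_smul] at h
      rw [neg_smul, h, neg_neg]
    · have h := hl (J2 m) X
      rw [e2, h2, neg_lie, map_smul] at h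
      rw [neg_smul, h, neg_neg]
  ext X
  constructor
  · rintro ⟨Y, hY, rfl⟩
    exact key α β Y hY
  · intro hX
    refine ⟨f X, ?_, hf X⟩
    have h := key _ _ X hX
    rwa [neg_neg, neg_neg] at h

theorem Ad_flip_Ad_flip (X : so m) : adLin (flip m) (adLin (flip m) X) = X := by
  rw [adLin_apply, adLin_apply, ← Ad_mul, flip_mul_self, Ad_one]

/-- θ and Ad(`flip m`) are different maps, but both are involutive automorphisms negating J₁ and J₂,
so they move each root space to the same place. The second comes from G and therefore acts on AdS.
-/
theorem algNbar_eq_map_Ad_flip : algNbar m = (algN m).map (adLin (flip m)) := by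
  have h1 : ∀ α β, (rootSpace m α β).map (theta m) = rootSpace m (-α) (-β) :=
    map_rootSpace theta_theta theta_lie (theta_boost _ _) (theta_boost _ _)
  have h2 : ∀ α β, (rootSpace m α β).map (adLin (flip m)) = rootSpace m (-α) (-β) :=
    map_rootSpace Ad_flip_Ad_flip (Ad_lie _) (Ad_flip_boost _ (Or.inl rfl))
      (Ad_flip_boost _ (Or.inr rfl))
  simp only [algNbar, algN, Submodule.map_sup, h1, h2]

theorem map_Ad_flip_algA : (algA m).map (adLin (flip m)) = algA m := by
  have e1 : adLin (flip m) (J1 m) = -J1 m := Ad_flip_boost _ (Or.inl rfl)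
  have e2 : adLin (flip m) (J2 m) = -J2 m := Ad_flip_boost _ (Or.inr rfl)
  have hle : (algA m).map (adLin (flip m)) ≤ algA m := by
    rw [algA, Submodule.map_span, Submodule.span_le, Set.image_pair, e1, e2]
    rintro X (rfl | rfl)
    · exact neg_mem (Submodule.subset_span (by simp))
    · exact neg_mem (Submodule.subset_span (by simp))
  refine le_antisymm hle fun X hX => ?_
  exact ⟨adLin (flip m) X, hle ⟨X, hX, rfl⟩, Ad_flip_Ad_flip X⟩

theorem expSubgroup_map_Ad (g : G m) (V : Submodule ℝ (so m)) :
    expSubgroup (V.map (adLin g)) = (expSubgroup V).map (MulAut.conj g).toMonoidHom := by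
  rw [expSubgroup, expSubgroup, MonoidHom.map_closure, Submodule.map_coe, Set.image_image,
    Set.image_image]
  congr 1
  refine Set.image_congr fun X _ => ?_
  rw [adLin_apply, expG_Ad]
  rfl

theorem ANbar_eq_map_conj : ANbar m = (AN m).map (MulAut.conj (flip m)).toMonoidHom := by
  rw [ANbar, AN, Subgroup.map_sup, ← expSubgroup_map_Ad, ← expSubgroup_map_Ad, map_Ad_flip_algA,
    algNbar_eq_map_Ad_flip]

theorem orbit_ANbar (p : AdS m) : MulAction.orbit (ANbar m) p =
    (fun q : AdS m => flip m • q) '' MulAction.orbit (AN m) (flip m • p) := by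
  have hc : ∀ h : G m, (flip m * h * (flip m)⁻¹) • p = flip m • h • flip m • p := by
    intro h
    rw [flip_inv, mul_smul, mul_smul]
  ext q
  constructor
  · rintro ⟨⟨k, hk⟩, rfl⟩
    rw [ANbar_eq_map_conj] at hk
    obtain ⟨h, hh, rfl⟩ := hk
    exact ⟨h • flip m • p, AN_smul hh _, (hc h).symm⟩
  · rintro ⟨_, ⟨⟨h, hh⟩, rfl⟩, rfl⟩
    refine ⟨⟨flip m * h * (flip m)⁻¹, ?_⟩, hc h⟩
    rw [ANbar_eq_map_conj]
    exact ⟨h, hh, rfl⟩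

/-- The flip acts as a homeomorphism carrying AN-orbits to A N̄-orbits, and turns t - x₁ into t +
x₁. -/
theorem isClosed_orbit_ANbar_iff (p : AdS m) :
    IsClosed (MulAction.orbit (ANbar m) p) ↔ emb p (Sum.inl 1) + emb p (Sum.inr 0) = 0 := by
  have h := (Homeomorph.smul (α := AdS m) (flip m)).isClosed_image
    (s := MulAction.orbit (AN m) (flip m • p))
  rw [isClosed_orbit_AN_iff, coordT_apply, emb_flip_smul, emb_flip_smul] at h
  rw [orbit_ANbar]
  refine h.trans ?_
  simp [flipSign]

/-! ### The singularity -/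

/-- An orbit containing p is the orbit of p, so the condition is (t - x₁)(t + x₁) = 0. -/
theorem mem_singularity_iff (p : AdS m) :
    p ∈ singularity m ↔ emb p (Sum.inr 0) ^ 2 - emb p (Sum.inl 1) ^ 2 = 0 := by
  have h1 : p ∈ singularity m ↔ IsClosed (MulAction.orbit (AN m) p) ∨
      IsClosed (MulAction.orbit (ANbar m) p) := by
    constructor
    · rintro ⟨O, ⟨hO, ⟨q, rfl⟩ | ⟨q, rfl⟩⟩, hp⟩
      · rw [MulAction.orbit_eq_iff.2 hp]
        exact Or.inl hO
      · rw [MulAction.orbit_eq_iff.2 hp]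
        exact Or.inr hO
    · rintro (h | h)
      · exact ⟨_, ⟨h, Or.inl ⟨p, rfl⟩⟩, MulAction.mem_orbit_self p⟩
      · exact ⟨_, ⟨h, Or.inr ⟨p, rfl⟩⟩, MulAction.mem_orbit_self p⟩
  rw [h1, isClosed_orbit_AN_iff, isClosed_orbit_ANbar_iff, coordT_apply, ← mul_eq_zero,
    ← neg_eq_zero]
  ring_nf

end BTZ

end

theorem mainTheorem2 (m : ℕ) :
    (∀ g : BTZ.G m,
      (∃ X ∈ BTZ.Q m, BTZ.fundamentalField (BTZ.J1 m) (BTZ.proj g) = BTZ.leftTangent g X) ∧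
      BTZ.tangentNorm (BTZ.proj g) (BTZ.fundamentalField (BTZ.J1 m) (BTZ.proj g)) =
        BTZ.killingNorm (BTZ.prQ m (BTZ.Ad g⁻¹ (BTZ.J1 m)))) ∧
    BTZ.singularity m =
      {p | BTZ.tangentNorm p (BTZ.fundamentalField (BTZ.J1 m) p) = 0} ∧
    (∀ g : BTZ.G m, BTZ.proj g ∈ BTZ.singularity m ↔
      BTZ.killingNorm (BTZ.prQ m (BTZ.Ad g⁻¹ (BTZ.J1 m))) = 0) := by
  refine ⟨fun g => ⟨⟨_, (BTZ.Q m).neg_mem (BTZ.prQ_mem_Q _),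
    BTZ.fundamentalField_eq_leftTangent g _⟩, BTZ.tangentNorm_fundamentalField g _⟩, ?_, ?_⟩
  · ext p
    obtain ⟨g, rfl⟩ := BTZ.proj_surjective p
    rw [BTZ.mem_singularity_iff, Set.mem_ofPred_eq, BTZ.tangentNorm_fundamentalField,
      BTZ.killingNorm_prQ_Ad_J1]
  · intro g
    rw [BTZ.mem_singularity_iff, BTZ.killingNorm_prQ_Ad_J1]
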